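/- Let $U\subset\mathbb R^n$ be open and let $f=(f^1,\dots,f^n)$, $B,A,N,M$ be smooth functions on $U$ such that the forms $B(u)\,dx+A(u)\,dt$ and $N(u)\,dx+M(u)\,dt$ are conservation laws of the system $u^i_t=\frac{d}{dx}f^i(u)$, $i=1,\dots,n$, i.e. $A_i=B_kf^k_i$ and $M_i=N_kf^k_i$ (a lower index $i$ denotes $\partial/\partial u^i$, repeated indices are summed). Suppose that the $n+4$ one-forms $dx$, $dt$, $u^i\,dx+f^i\,dt$, $B\,dx+A\,dt$, $N\,dx+M\,dt$ are linearly independent over $\mathbb R$. Let $\Sigma\subset\mathbb P^{n+3}$ be the codimension-2 hypersurface swept out by the lines spanned by $$p(u)=[1:u^1:\dots:u^n:B:N:0],\qquad r(u)=[0:f^1:\dots:f^n:A:M:1],\qquad u\in U,$$ and let $\Sigma^*$ be the dual hypersurface, the set of hyperplanes tangent to $\Sigma$ at its regular points, i.e. the points at which the parametrization $(u,[s:t])\mapsto[s\,p(u)+t\,r(u)]$ is an immersion. Call $\Sigma$ ruled by projective subspaces of dimension $k$ if through each point of $\Sigma$ with parameters in some dense open set there passes a $k$-dimensional projective subspace that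 is contained in $\Sigma$ near that point. Assume that 1) $\Sigma$ is not ruled by projective subspaces of any dimension $k>1$; 2) the projective tangent spaces of $\Sigma$ (at its regular points) have no common point. Then: (a) $\Sigma^*$ is ruled by lines: the hyperplanes tangent to $\Sigma$ at any regular point of the generator $p(u)r(u)$ form the pencil $$Z_0=(u^iB_i-B)Z_{n+1}+(u^iN_i-N)Z_{n+2},\quad Z_i=-B_iZ_{n+1}-N_iZ_{n+2},\quad Z_{n+3}=(f^iB_i-A)Z_{n+1}+(f^iN_i-M)Z_{n+2},$$ where $Z_0,\dots,Z_{n+3}$ are the dual homogeneous coordinates, with incidence $\sum_{j=0}^{n+3}Z_jY^j=0$, and $\Sigma^*$ is the union of these lines over $u\in U$. (b) $\Sigma^*$ has codimension 2, i.e. its parametrization by $u$ and the point on the line is an immersion at some point. It is an immersion at a dense set of points if the data are real analytic and $U$ is connected, or if no part of $\Sigma$ lying over a nonempty open subset of $U$ is ruled by projective subspaces of some dimension $k>1$. (c) $\Sigma^*$ is not contained in a proper projective subspace. (d) The projective tangent spaces of $\Sigma^*$ are stable along its generators, i.e. the same at all regular points of a generator. (e) Near every generator that contains a regular point of $\Sigma^*$,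 after a smooth change of the parameters $u$ and a projective transformation, the generators of $\Sigma^*$ are the lines assigned, as above, to a system of $n$ conservation laws with two additional conservation laws. The $n+4$ one-forms of that system are linearly independent if the data are real analytic and $U$ is connected, or if the projective tangent spaces of the corresponding part of $\Sigma$ have no common point. -/

import Mathlib

open scoped ContDiff Topology LinearAlgebra.Projectivization

noncomputable section

/-- Homogeneous coordinates `(Y⁰, (Y¹, …, Yⁿ), Yⁿ⁺¹, Yⁿ⁺², Yⁿ⁺³)` on `ℙⁿ⁺³`. The same space, with
the coordinates `Z_i`, is used for the dual projective space. -/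
abbrev HomCoord (n : ℕ) : Type := ℝ × (Fin n → ℝ) × ℝ × ℝ × ℝ

/-- The incidence pairing `∑ Z_i Y^i`. -/
def incidence {n : ℕ} (Z Y : HomCoord n) : ℝ :=
  Z.1 * Y.1 + Z.2.1 ⬝ᵥ Y.2.1 + Z.2.2.1 * Y.2.2.1 + Z.2.2.2.1 * Y.2.2.2.1
    + Z.2.2.2.2 * Y.2.2.2.2

/-! ### Hypersurfaces ruled by an `n`-parameter family of lines

Such a family is given by two functions `P`, `R` of the parameter `u`, the line with parameter `u`
being spanned by the points `P u` and `R u`. -/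

section RuledFamilies

variable {n : ℕ}

/-- The homogeneous coordinates `s P(u) + t R(u)` of the point with parameters `(u, s, t)`. -/
def rulingPoint (P R : (Fin n → ℝ) → HomCoord n) (q : (Fin n → ℝ) × ℝ × ℝ) : HomCoord n :=
  q.2.1 • P q.1 + q.2.2 • R q.1

/-- The generator with parameter `u`, as a linear subspace. -/
def generator (P R : (Fin n → ℝ) → HomCoord n) (u : Fin n → ℝ) : Submodule ℝ (HomCoord n) :=
  Submodule.span ℝ {P u, R u}

/-- The swept out set: the union of the generators with parameter in `W`. -/
def ruledSet (P R : (Fin n → ℝ) → HomCoord n) (W : Set (Fin n → ℝ)) : Set (ℙ ℝ (HomCoord n)) :=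
  {x | ∃ u ∈ W, x.submodule ≤ generator P R u}

/-- The projective tangent space at the point with parameters `q = (u, s, t)`, as a linear
subspace: it is spanned by `P u`, `R u` and the vectors `s ∂_i P + t ∂_i R`. -/
def projTangent (P R : (Fin n → ℝ) → HomCoord n) (q : (Fin n → ℝ) × ℝ × ℝ) :
    Submodule ℝ (HomCoord n) :=
  LinearMap.range (fderiv ℝ (rulingPoint P R) q : (Fin n → ℝ) × ℝ × ℝ →ₗ[ℝ] HomCoord n)

/-- The swept out set is immersed at `q`, with an `(n+1)`-dimensional projective tangent space
(so it has codimension two there). -/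
def IsRegularAt (P R : (Fin n → ℝ) → HomCoord n) (q : (Fin n → ℝ) × ℝ × ℝ) : Prop :=
  Function.Injective (fderiv ℝ (rulingPoint P R) q)

/-- The parameters, over `W`, of the regular points. -/
def regularSet (P R : (Fin n → ℝ) → HomCoord n) (W : Set (Fin n → ℝ)) :
    Set ((Fin n → ℝ) × ℝ × ℝ) :=
  {q | q.1 ∈ W ∧ IsRegularAt P R q}

/-- The dual: the set of the hyperplanes that are tangent at some regular point. -/
def dualSet (P R : (Fin n → ℝ) → HomCoord n) (W : Set (Fin n → ℝ)) : Set (ℙ ℝ (HomCoord n)) :=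
  {z | ∃ q ∈ regularSet P R W, ∀ Z ∈ z.submodule, ∀ Y ∈ projTangent P R q, incidence Z Y = 0}

/-- The part over `W` is ruled by `r`-dimensional projective subspaces: through each of its general
points (those with parameters in a dense open set) there is an `r`-dimensional projective subspace
which, near that point, is contained in the swept out set. -/
def IsRuledBy (P R : (Fin n → ℝ) → HomCoord n) (W : Set (Fin n → ℝ)) (r : ℕ) : Prop :=
  ∃ G ⊆ regularSet P R W, IsOpen G ∧ W ×ˢ Set.univ ⊆ closure G ∧
    ∀ q ∈ G, ∃ L : Submodule ℝ (HomCoord n),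
      Module.finrank ℝ L = r + 1 ∧ rulingPoint P R q ∈ L ∧
      ∀ᶠ y in 𝓝[(L : Set (HomCoord n))] (rulingPoint P R q),
        ∀ hy : y ≠ 0, Projectivization.mk ℝ y hy ∈ ruledSet P R W

/-- All the projective tangent spaces over `W` have a common point. -/
def TangentsConcurrent (P R : (Fin n → ℝ) → HomCoord n) (W : Set (Fin n → ℝ)) : Prop :=
  ∃ y : HomCoord n, y ≠ 0 ∧ ∀ q ∈ regularSet P R W, y ∈ projTangent P R q

/-- The projective tangent space is the same at all regular points of a generator. -/
def TangentsStable (P R : (Fin n → ℝ) → HomCoord n) (W : Set (Fin n → ℝ)) : Prop :=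
  ∀ q ∈ regularSet P R W, ∀ q' ∈ regularSet P R W,
    q.1 = q'.1 → projTangent P R q = projTangent P R q'

end RuledFamilies

/-! ### Systems of conservation laws -/

/-- The system `uⁱ_t = d/dx fⁱ(u)` together with two forms `B dx + A dt` and `N dx + M dt`. -/
structure ConsSystem (n : ℕ) where
  f : (Fin n → ℝ) → (Fin n → ℝ)
  B : (Fin n → ℝ) → ℝ
  A : (Fin n → ℝ) → ℝ
  N : (Fin n → ℝ) → ℝ
  M : (Fin n → ℝ) → ℝ

/-- `B(u) dx + A(u) dt` is closed by virtue of `u_t = d/dx f(u)`: one has `d/dt B(u) = d/dx A(u)`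
for all values of `u`, `u_x`, `u_t` that are compatible with the system. -/
def IsConservationLaw {n : ℕ} (f : (Fin n → ℝ) → (Fin n → ℝ)) (U : Set (Fin n → ℝ))
    (B A : (Fin n → ℝ) → ℝ) : Prop :=
  ∀ u ∈ U, ∀ ux ut : Fin n → ℝ, ut = fderiv ℝ f u ux → fderiv ℝ B u ut = fderiv ℝ A u ux

/-- The vector `(B_1, …, B_n)` of partial derivatives. -/
def partials {n : ℕ} (B : (Fin n → ℝ) → ℝ) (u : Fin n → ℝ) : Fin n → ℝ :=
  fun i => fderiv ℝ B u (Pi.single i 1)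

namespace ConsSystem

variable {n : ℕ}

/-- The data are smooth on the open set `U` and both forms are additional conservation laws. -/
structure HasTwoLaws (S : ConsSystem n) (U : Set (Fin n → ℝ)) : Prop where
  isOpen : IsOpen U
  smooth_f : ContDiffOn ℝ ∞ S.f U
  smooth_B : ContDiffOn ℝ ∞ S.B U
  smooth_A : ContDiffOn ℝ ∞ S.A U
  smooth_N : ContDiffOn ℝ ∞ S.N U
  smooth_M : ContDiffOn ℝ ∞ S.M U
  law_BA : IsConservationLaw S.f U S.B S.A
  law_NM : IsConservationLaw S.f U S.N S.M

/-- The `n + 4` one-forms `dx`, `dt`, `uⁱ dx + fⁱ dt`, `B dx + A dt`, `N dx + M dt` are linearly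
independent over `ℝ`. -/
def Independent (S : ConsSystem n) (U : Set (Fin n → ℝ)) : Prop :=
  ∀ (a b : ℝ) (c : Fin n → ℝ) (d e : ℝ),
    (∀ u ∈ U, a + c ⬝ᵥ u + d * S.B u + e * S.N u = 0 ∧
      b + c ⬝ᵥ S.f u + d * S.A u + e * S.M u = 0) →
    a = 0 ∧ b = 0 ∧ c = 0 ∧ d = 0 ∧ e = 0

/-- The data are real analytic on `U`. -/
def IsAnalytic (S : ConsSystem n) (U : Set (Fin n → ℝ)) : Prop :=
  AnalyticOnNhd ℝ S.f U ∧ AnalyticOnNhd ℝ S.B U ∧ AnalyticOnNhd ℝ S.A U ∧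
    AnalyticOnNhd ℝ S.N U ∧ AnalyticOnNhd ℝ S.M U

/-- The point `[1 : u¹ : … : uⁿ : B : N : 0]`. With `S.r` it spans the generator
`Yⁱ = uⁱ Y⁰ + fⁱ Yⁿ⁺³`, `Yⁿ⁺¹ = B Y⁰ + A Yⁿ⁺³`, `Yⁿ⁺² = N Y⁰ + M Yⁿ⁺³`. -/
def p (S : ConsSystem n) (u : Fin n → ℝ) : HomCoord n := (1, u, S.B u, S.N u, 0)

/-- The point `[0 : f¹ : … : fⁿ : A : M : 1]`. -/
def r (S : ConsSystem n) (u : Fin n → ℝ) : HomCoord n := (0, S.f u, S.A u, S.M u, 1)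

/-- The point of the dual space with `Z_{n+1} = 1`, `Z_{n+2} = 0` on the dual generator
`Z_0 = (uⁱB_i - B) Z_{n+1} + (uⁱN_i - N) Z_{n+2}`, `Z_i = -B_i Z_{n+1} - N_i Z_{n+2}`,
`Z_{n+3} = (fⁱB_i - A) Z_{n+1} + (fⁱN_i - M) Z_{n+2}`. -/
def dualP (S : ConsSystem n) (u : Fin n → ℝ) : HomCoord n :=
  (u ⬝ᵥ partials S.B u - S.B u, -partials S.B u, 1, 0, S.f u ⬝ᵥ partials S.B u - S.A u)

/-- The point with `Z_{n+1} = 0`, `Z_{n+2} = 1` on the same dual generator. -/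
def dualR (S : ConsSystem n) (u : Fin n → ℝ) : HomCoord n :=
  (u ⬝ᵥ partials S.N u - S.N u, -partials S.N u, 0, 1, S.f u ⬝ᵥ partials S.N u - S.M u)

end ConsSystem

end

/-! The conservation laws say that `p` and `r` move in the same directions: with `primalLift w = (0,
w, B_i w^i, N_i w^i, 0)` one has `dp = primalLift` and `dr = primalLift ∘ df`. Hence the
differential of the parametrization of Σ is governed by the n × n pencil `s I + t df`. Where this
pencil is invertible, the tangent space is spanned by `p`, `r` and the image of `primalLift`, so it
depends on `u` only. Its annihilator is the explicit pencil spanned by `dualP` and `dualR`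
(`incidence_projTangent_eq_zero_iff`).

The dual side has the same shape. By a Legendre-type cancellation the derivatives of `dualP` and
`dualR` are one lift `dualLift` composed with the Hessians of `B` and `N`, so regularity of the dual
is invertibility of `s Hess B + t Hess N`. The tangent spaces of the dual always lie in the
annihilator of the generator `p(u) r(u)`, and equal it at regular points. This gives stability along
generators. A point `y` orthogonal to all dual generators lies in all tangent spaces of Σ, which
gives the statement on spans.

The main point is codimension two. If the dual has no regular point, take a point where the rank of
its parametrization is locally constant. Its fibre has positive dimension d, and the tangent space R
is constant along it (`exists_fiber_parametrization`). All generators of Σ over the fibre then lie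
in the annihilator L of R, of linear dimension d + 2. They form a family with d + 2 parameters,
immersed at regular points of Σ, so they fill a neighbourhood in L. Thus Σ contains pieces of
planes, contrary to the assumption (`exists_subspace_of_rank_lt`, `isRuledBy_two`).

Finally, near a regular dual point with parameters `(u, s, t)` the gradient coordinates `-(s ∇B + t
∇N)` are new parameters. In the rotated basis with coefficients `(s, t)` and `(-t, s)`, and after a
linear coordinate change, the dual generators take the standard form of a system. The old `u` and
`f` become, up to sign, the gradients of the two new densities (`exists_dualSystem`). -/

noncomputable section

/-! ### Rank, constant rank fibres and analytic density. -/

section Generic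

variable {E F : Type*} [NormedAddCommGroup E] [NormedSpace ℝ E]
  [NormedAddCommGroup F] [NormedSpace ℝ F]

/-- The rank of a linear map is lower semicontinuous. -/
theorem eventually_finrank_range_le [FiniteDimensional ℝ E] [FiniteDimensional ℝ F]
    (A₀ : E →L[ℝ] F) :
    ∀ᶠ A : E →L[ℝ] F in 𝓝 A₀, Module.finrank ℝ (LinearMap.range (A₀ : E →ₗ[ℝ] F)) ≤
      Module.finrank ℝ (LinearMap.range (A : E →ₗ[ℝ] F)) := by
  -- On a complement of the kernel `A₀` is injective, and injectivity is an open condition.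
  obtain ⟨C, hC⟩ := Submodule.exists_isCompl (LinearMap.ker (A₀ : E →ₗ[ℝ] F))
  have hcont : Continuous fun A : E →L[ℝ] F => A.comp C.subtypeL := by fun_prop
  have hinj : Function.Injective (A₀.comp C.subtypeL) := by
    rw [injective_iff_map_eq_zero]
    intro x hx
    have h1 : (x : E) ∈ LinearMap.ker (A₀ : E →ₗ[ℝ] F) ⊓ C := ⟨hx, x.2⟩
    rw [hC.inf_eq_bot] at h1
    exact Subtype.ext h1
  have hopen := (ContinuousLinearMap.isOpen_injective (𝕜 := ℝ) (E := C) (F := F)).preimage hcont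
  filter_upwards [hopen.mem_nhds hinj] with A hA
  have h1 := LinearMap.finrank_range_add_finrank_ker (A₀ : E →ₗ[ℝ] F)
  have h2 := Submodule.finrank_add_eq_of_isCompl hC
  have h3 : Module.finrank ℝ C = Module.finrank ℝ (LinearMap.range ((A.comp C.subtypeL) : C →ₗ[ℝ] F)) :=
    (LinearMap.finrank_range_of_inj hA).symm
  have h4 : LinearMap.range ((A.comp C.subtypeL) : C →ₗ[ℝ] F) ≤ LinearMap.range (A : E →ₗ[ℝ] F) := by
    rintro _ ⟨x, rfl⟩
    exact ⟨x, rfl⟩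
  have h5 := Submodule.finrank_mono h4
  omega

/-- The dimension is lowered one step at a time: in dimension at least two the line through `x` is
proper, so some nonzero functional kills `x`, and its kernel is a hyperplane. -/
theorem exists_submodule_finrank_eq [FiniteDimensional ℝ E] (L : Submodule ℝ E) (x : E)
    (hx : x ∈ L) (m : ℕ) (hm : 1 ≤ m) (hL : m ≤ Module.finrank ℝ L) :
    ∃ C ≤ L, x ∈ C ∧ Module.finrank ℝ C = m := by
  induction hL using Nat.decreasingInduction with
  | self => exact ⟨L, le_rfl, hx, rfl⟩
  | of_succ k hk ih =>
    obtain ⟨C, hCL, hxC, hC⟩ := ih (by omega)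
    have hlt : (ℝ ∙ (⟨x, hxC⟩ : C)) < ⊤ := by
      refine lt_top_iff_ne_top.2 fun htop => ?_
      have h2 : Module.finrank ℝ (ℝ ∙ (⟨x, hxC⟩ : C)) ≤ 1 := by
        simpa using finrank_span_le_card (R := ℝ) ({(⟨x, hxC⟩ : C)} : Set C)
      rw [htop, finrank_top] at h2
      omega
    obtain ⟨φ, hφ, hker⟩ := Submodule.exists_le_ker_of_lt_top _ hlt
    refine ⟨(LinearMap.ker φ).map C.subtype, ?_, ?_, ?_⟩
    · rintro _ ⟨y, -, rfl⟩
      exact hCL y.2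
    · exact ⟨⟨x, hxC⟩, hker (Submodule.mem_span_singleton_self _), rfl⟩
    · have h3 := Module.Dual.finrank_ker_add_one_of_ne_zero hφ
      rw [LinearEquiv.finrank_eq (Submodule.equivMapOfInjective C.subtype C.subtype_injective _).symm]
      omega

/-- Near a point at which the rank of the derivative is locally constant, the fibre is
parametrized by the kernel of the derivative, and the range of the derivative is constant along
the fibre. -/
theorem exists_fiber_parametrization [FiniteDimensional ℝ E] [FiniteDimensional ℝ F]
    {h : E → F} {O : Set E} (hO : IsOpen O) (hh : ContDiffOn ℝ 1 h O) {x₀ : E} (hx₀ : x₀ ∈ O)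
    (hrank : ∀ x ∈ O, Module.finrank ℝ (LinearMap.range (fderiv ℝ h x : E →ₗ[ℝ] F)) =
      Module.finrank ℝ (LinearMap.range (fderiv ℝ h x₀ : E →ₗ[ℝ] F))) :
    ∃ ψ : LinearMap.ker (fderiv ℝ h x₀ : E →ₗ[ℝ] F) → E, ψ 0 = x₀ ∧
      HasStrictFDerivAt ψ (LinearMap.ker (fderiv ℝ h x₀ : E →ₗ[ℝ] F)).subtypeL 0 ∧
      ∀ᶠ k in 𝓝 0, ψ k ∈ O ∧ h (ψ k) = h x₀ ∧
        LinearMap.range (fderiv ℝ h (ψ k) : E →ₗ[ℝ] F) =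
          LinearMap.range (fderiv ℝ h x₀ : E →ₗ[ℝ] F) := by
  set A₀ := fderiv ℝ h x₀ with hA₀
  set K := LinearMap.ker (A₀ : E →ₗ[ℝ] F) with hK
  set R := LinearMap.range (A₀ : E →ₗ[ℝ] F) with hR
  obtain ⟨π, hπ⟩ : R.ClosedComplemented := .of_finiteDimensional R
  obtain ⟨κ, hκ⟩ : K.ClosedComplemented := .of_finiteDimensional K
  have hh1 : ∀ x ∈ O, ContDiffAt ℝ 1 h x := fun x hx => hh.contDiffAt (hO.mem_nhds hx)
  have hhd : ∀ x ∈ O, HasFDerivAt h (fderiv ℝ h x) x := fun x hx =>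
    ((hh1 x hx).differentiableAt one_ne_zero).hasFDerivAt
  -- Straightening map: the component of `h` along the range, together with the displacement along
  -- the kernel, is a local diffeomorphism at `x₀`.
  set Ψ : E → R × K := fun x => (π (h x), κ (x - x₀)) with hΨ
  have hΨd : ∀ x ∈ O, HasFDerivAt Ψ ((π.comp (fderiv ℝ h x)).prod κ) x := fun x hx =>
    (π.hasFDerivAt.comp x (hhd x hx)).prodMk
      (κ.hasFDerivAt.comp x ((hasFDerivAt_id x).sub_const x₀))
  have hΨc : ContDiffAt ℝ 1 Ψ x₀ :=
    (π.contDiff.contDiffAt.comp x₀ (hh1 x₀ hx₀)).prodMk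
      (κ.contDiff.contDiffAt.comp x₀ (contDiffAt_id.sub contDiffAt_const))
  have hker : ∀ k : K, A₀ k = 0 := fun k => k.2
  have hBinj : Function.Injective ((π.comp A₀).prod κ) := by
    rw [injective_iff_map_eq_zero]
    intro x hx
    have h1 : π (A₀ x) = 0 := congrArg Prod.fst hx
    have h2 : κ x = 0 := congrArg Prod.snd hx
    have h3 : A₀ x = 0 := by
      have := hπ ⟨A₀ x, ⟨x, rfl⟩⟩
      rw [h1] at this
      exact (congrArg Subtype.val this).symm
    have := hκ ⟨x, h3⟩
    rw [h2] at this
    exact (congrArg Subtype.val this).symm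
  have hdim : Module.finrank ℝ E = Module.finrank ℝ (R × K) := by
    rw [Module.finrank_prod]
    exact (LinearMap.finrank_range_add_finrank_ker (A₀ : E →ₗ[ℝ] F)).symm
  have hBsurj : Function.Surjective ((π.comp A₀).prod κ) :=
    (LinearMap.injective_iff_surjective_of_finrank_eq_finrank
      (f := (((π.comp A₀).prod κ : E →L[ℝ] R × K) : E →ₗ[ℝ] R × K)) hdim).1 hBinj
  set e : E ≃L[ℝ] R × K := ContinuousLinearEquiv.ofBijective ((π.comp A₀).prod κ)
    (LinearMap.ker_eq_bot.2 hBinj) (LinearMap.range_eq_top.2 hBsurj) with he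
  have heq : (e : E →L[ℝ] R × K) = (π.comp A₀).prod κ :=
    ContinuousLinearEquiv.coe_ofBijective _ _ _
  have hΨe : HasFDerivAt Ψ (e : E →L[ℝ] R × K) x₀ := by
    rw [heq]
    exact hΨd x₀ hx₀
  have hstrict := hΨc.hasStrictFDerivAt' hΨe one_ne_zero
  set χ : R × K → E := hΨc.localInverse hΨe one_ne_zero with hχ
  set z₀ : R × K := Ψ x₀ with hz₀
  have hχ0 : χ z₀ = x₀ := hΨc.localInverse_apply_image hΨe one_ne_zero
  have hχc : ContDiffAt ℝ 1 χ z₀ := hΨc.to_localInverse hΨe one_ne_zero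
  have hχs : HasStrictFDerivAt χ (e.symm : R × K →L[ℝ] E) z₀ := hstrict.to_localInverse
  have hgood : ∀ᶠ z in 𝓝 z₀, ContDiffAt ℝ 1 χ z ∧ χ z ∈ O ∧ ∀ᶠ w in 𝓝 z, Ψ (χ w) = w := by
    refine (hχc.eventually (by simp)).and (Filter.Eventually.and ?_ ?_)
    · refine hχc.continuousAt.eventually_mem ?_
      rw [hχ0]
      exact hO.mem_nhds hx₀
    · exact hstrict.eventually_right_inverse.eventually_nhds
  obtain ⟨ε, hε, hball⟩ := Metric.eventually_nhds_iff_ball.1 hgood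
  have hz₀2 : z₀.2 = 0 := by simp [hz₀, hΨ]
  have hprod : Metric.ball z₀ ε = Metric.ball z₀.1 ε ×ˢ Metric.ball (0 : K) ε := by
    rw [← hz₀2]
    exact (ball_prod_same _ _ _).symm
  have hmem : ∀ y k, y ∈ Metric.ball z₀.1 ε → k ∈ Metric.ball (0 : K) ε →
      ((y, k) : R × K) ∈ Metric.ball z₀ ε := by
    intro y k hy hk
    rw [hprod]
    exact ⟨hy, hk⟩
  have hgd : ∀ z ∈ Metric.ball z₀ ε,
      HasFDerivAt (h ∘ χ) ((fderiv ℝ h (χ z)).comp (fderiv ℝ χ z)) z := fun z hz =>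
    (hhd _ (hball z hz).2.1).comp z
      ((hball z hz).1.differentiableAt one_ne_zero).hasFDerivAt
  have hcompid : ∀ z ∈ Metric.ball z₀ ε,
      ((π.comp (fderiv ℝ h (χ z))).prod κ).comp (fderiv ℝ χ z) = ContinuousLinearMap.id ℝ _ := by
    intro z hz
    have h1 := (hΨd _ (hball z hz).2.1).comp z
      ((hball z hz).1.differentiableAt one_ne_zero).hasFDerivAt
    exact (h1.congr_of_eventuallyEq ((hball z hz).2.2.mono fun w hw => hw.symm)).unique
      (hasFDerivAt_id z)
  have hχsurj : ∀ z ∈ Metric.ball z₀ ε, Function.Surjective (fderiv ℝ χ z) := by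
    intro z hz
    refine (LinearMap.injective_iff_surjective_of_finrank_eq_finrank
      (f := (fderiv ℝ χ z : R × K →ₗ[ℝ] E)) hdim.symm).1 ?_
    refine Function.LeftInverse.injective
      (g := (π.comp (fderiv ℝ h (χ z))).prod κ) fun w => ?_
    exact DFunLike.congr_fun (hcompid z hz) w
  have hrange : ∀ z ∈ Metric.ball z₀ ε,
      LinearMap.range ((fderiv ℝ h (χ z)).comp (fderiv ℝ χ z) : R × K →ₗ[ℝ] F) =
        LinearMap.range (fderiv ℝ h (χ z) : E →ₗ[ℝ] F) := by
    intro z hz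
    exact LinearMap.range_comp_of_range_eq_top (f := (fderiv ℝ χ z : R × K →ₗ[ℝ] E)) _
      (LinearMap.range_eq_top.2 (hχsurj z hz))
  -- Constant rank enters here. `π` maps the range of the derivative at `χ z` onto `R`, and the
  -- dimensions agree, so it is injective there; it kills the derivative in the kernel directions,
  -- hence that derivative vanishes.
  have hzero : ∀ z ∈ Metric.ball z₀ ε, ∀ k : K,
      (fderiv ℝ h (χ z)) (fderiv ℝ χ z (0, k)) = 0 := by
    intro z hz k
    set Q := LinearMap.range (fderiv ℝ h (χ z) : E →ₗ[ℝ] F) with hQ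
    have hid : ∀ w, π (fderiv ℝ h (χ z) (fderiv ℝ χ z w)) = w.1 := fun w =>
      congrArg Prod.fst (DFunLike.congr_fun (hcompid z hz) w)
    have hinj : Function.Injective ((π : F →ₗ[ℝ] R).comp Q.subtype) := by
      refine (LinearMap.injective_iff_surjective_of_finrank_eq_finrank
        (hrank _ (hball z hz).2.1)).2 fun y => ?_
      exact ⟨⟨_, ⟨fderiv ℝ χ z (y, 0), rfl⟩⟩, hid (y, 0)⟩
    have h1 : (⟨_, ⟨fderiv ℝ χ z (0, k), rfl⟩⟩ : Q) = 0 := by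
      refine hinj ?_
      rw [map_zero]
      exact hid (0, k)
    exact congrArg Subtype.val h1
  have hconst : ∀ y ∈ Metric.ball z₀.1 ε, ∀ k ∈ Metric.ball (0 : K) ε,
      h (χ (y, k)) = h (χ (y, 0)) := by
    intro y hy k hk
    have hd : ∀ k ∈ Metric.ball (0 : K) ε, HasFDerivAt (fun k => h (χ (y, k)))
        (((fderiv ℝ h (χ (y, k))).comp (fderiv ℝ χ (y, k))).comp
          (ContinuousLinearMap.inr ℝ R K)) k := fun k hk =>
      (hgd _ (hmem y k hy hk)).comp k (hasFDerivAt_prodMk_right y k)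
    refine Metric.isOpen_ball.is_const_of_fderiv_eq_zero
      (convex_ball (0 : K) ε).isPreconnected
      (fun k hk => (hd k hk).differentiableAt.differentiableWithinAt) ?_ hk
      (Metric.mem_ball_self hε)
    intro k hk
    rw [(hd k hk).fderiv]
    ext v
    exact hzero _ (hmem y k hy hk) v
  refine ⟨fun k => χ (z₀.1, k), ?_, ?_, ?_⟩
  · rw [← hz₀2]
    exact hχ0
  · have h1 : HasStrictFDerivAt (fun k : K => ((z₀.1, k) : R × K))
        (ContinuousLinearMap.inr ℝ R K) 0 :=
      (hasStrictFDerivAt_const _ _).prodMk (hasStrictFDerivAt_id _)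
    have h2 : HasStrictFDerivAt χ (e.symm : R × K →L[ℝ] E) ((z₀.1, (0 : K)) : R × K) := by
      rw [← hz₀2]
      exact hχs
    have h3 : K.subtypeL =
        (e.symm : R × K →L[ℝ] E).comp (ContinuousLinearMap.inr ℝ R K) := by
      ext k
      refine e.injective ?_
      change (e : E →L[ℝ] R × K) k = e (e.symm (0, k))
      rw [e.apply_symm_apply, heq]
      change (π (A₀ k), κ k) = _
      rw [hker, map_zero, hκ]
    rw [h3]
    exact h2.comp (0 : K) h1
  · filter_upwards [Metric.ball_mem_nhds (0 : K) hε] with k hk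
    have hy := Metric.mem_ball_self (x := z₀.1) hε
    have hz := hmem _ _ hy hk
    refine ⟨(hball _ hz).2.1, ?_, ?_⟩
    · rw [hconst _ hy k hk, ← hz₀2]
      exact congrArg h hχ0
    · refine Submodule.eq_of_le_of_finrank_eq ?_ (hrank _ (hball _ hz).2.1)
      have hz00 : ((z₀.1, (0 : K)) : R × K) = z₀ := by rw [← hz₀2]
      -- Near this point `h ∘ χ` factors through the slice with zero kernel component, so its
      -- derivative has range inside the range at `x₀`; equal ranks then give equality.
      have hev : (h ∘ χ) =ᶠ[𝓝 ((z₀.1, k) : R × K)] fun w => (h ∘ χ) (w.1, 0) := by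
        filter_upwards [Metric.isOpen_ball.mem_nhds hz] with w hw
        rw [hprod] at hw
        exact hconst w.1 hw.1 w.2 hw.2
      have hz' : ((z₀.1, (0 : K)) : R × K) ∈ Metric.ball z₀ ε :=
        hmem _ _ hy (Metric.mem_ball_self hε)
      have hJ : HasFDerivAt (fun w : R × K => ((w.1, 0) : R × K))
          ((ContinuousLinearMap.fst ℝ R K).prod 0) ((z₀.1, k) : R × K) :=
        hasFDerivAt_fst.prodMk (hasFDerivAt_const _ _)
      have hd2 := (HasFDerivAt.comp ((z₀.1, k) : R × K) (hgd _ hz') hJ).congr_of_eventuallyEq hev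
      have heq2 := (hgd _ hz).unique hd2
      rw [← hrange _ hz, heq2, hz00, hχ0]
      rintro _ ⟨w, rfl⟩
      exact ⟨_, rfl⟩

/-- For an analytic family of endomorphisms, injectivity at one point implies injectivity on a
dense set. -/
theorem subset_closure_setOf_injective {n : ℕ} {O : Set E} (hO : IsOpen O) (hc : IsPreconnected O)
    {Λ : E → (Fin n → ℝ) →L[ℝ] (Fin n → ℝ)} (hΛ : AnalyticOnNhd ℝ Λ O) {x₀ : E} (hx₀ : x₀ ∈ O)
    (hinj : Function.Injective (Λ x₀)) : O ⊆ closure {x | x ∈ O ∧ Function.Injective (Λ x)} := by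
  -- Injectivity is nonvanishing of an analytic determinant, to which the identity theorem applies.
  set D : E → ℝ := fun x => (LinearMap.toMatrix' (Λ x : (Fin n → ℝ) →ₗ[ℝ] (Fin n → ℝ))).det with hD
  have hDinj : ∀ x, Function.Injective (Λ x) ↔ D x ≠ 0 := by
    intro x
    have h1 : D x = LinearMap.det (Λ x : (Fin n → ℝ) →ₗ[ℝ] (Fin n → ℝ)) := by
      simp [hD, LinearMap.det_toMatrix']
    rw [h1, ← isUnit_iff_ne_zero, ← LinearMap.isUnit_iff_isUnit_det, LinearMap.isUnit_iff_ker_eq_bot,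
      LinearMap.ker_eq_bot]
    rfl
  have hDan : AnalyticOnNhd ℝ D O := by
    intro x hx
    simp only [hD, Matrix.det_apply']
    refine Finset.analyticAt_fun_sum _ fun σ _ => analyticAt_const.mul ?_
    refine Finset.analyticAt_fun_prod _ fun i _ => ?_
    have h2 : AnalyticAt ℝ (fun y => ((ContinuousLinearMap.proj (R := ℝ) (σ i)).comp
        (ContinuousLinearMap.apply ℝ (Fin n → ℝ) (Pi.single i (1 : ℝ)))) (Λ y)) x :=
      (ContinuousLinearMap.analyticAt _ _).comp (hΛ x hx)
    have h3 : ∀ y, LinearMap.toMatrix' (Λ y : (Fin n → ℝ) →ₗ[ℝ] (Fin n → ℝ)) (σ i) i =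
        Λ y (Pi.single i 1) (σ i) := fun y => LinearMap.toMatrix'_apply _ _ _
    simp only [h3]
    exact h2
  intro x hx
  by_contra hcl
  rw [mem_closure_iff_frequently, Filter.not_frequently] at hcl
  refine (hDinj x₀).1 hinj (hDan.eqOn_zero_of_preconnected_of_eventuallyEq_zero hc hx ?_ hx₀)
  filter_upwards [hcl, hO.mem_nhds hx] with y hy hyO
  by_contra h0
  exact hy ⟨hyO, (hDinj y).2 h0⟩

end Generic

/-! ### Derivatives of dot products, gradients and ruled parametrizations. -/

section Calculus

variable {n : ℕ}

/-- The linear functional `w ↦ a ⬝ᵥ w`. -/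
def dotCLM (a : Fin n → ℝ) : (Fin n → ℝ) →L[ℝ] ℝ :=
  ∑ i, a i • ContinuousLinearMap.proj i

@[simp]
theorem dotCLM_apply (a w : Fin n → ℝ) : dotCLM a w = a ⬝ᵥ w := by
  simp [dotCLM, dotProduct]

theorem HasFDerivAt.dotProduct {g G : (Fin n → ℝ) → (Fin n → ℝ)}
    {g' G' : (Fin n → ℝ) →L[ℝ] (Fin n → ℝ)} {u : Fin n → ℝ}
    (hg : HasFDerivAt g g' u) (hG : HasFDerivAt G G' u) :
    HasFDerivAt (fun u => g u ⬝ᵥ G u) ((dotCLM (g u)).comp G' + (dotCLM (G u)).comp g') u := by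
  have h := HasFDerivAt.fun_sum (u := Finset.univ)
    fun i _ => ((hasFDerivAt_pi'.1 hg i).mul (hasFDerivAt_pi'.1 hG i))
  refine h.congr_fderiv ?_
  ext w
  simp [_root_.dotProduct, Finset.sum_add_distrib]

theorem fderiv_eq_dotCLM_partials (B : (Fin n → ℝ) → ℝ) (u : Fin n → ℝ) :
    fderiv ℝ B u = dotCLM (partials B u) := by
  ext w
  have h := LinearMap.pi_apply_eq_sum_univ (fderiv ℝ B u : (Fin n → ℝ) →ₗ[ℝ] ℝ) w
  have h2 : ∀ i : Fin n, (fun j => if i = j then (1 : ℝ) else 0) = Pi.single i 1 := by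
    intro i
    ext j
    simp [Pi.single_apply, eq_comm]
  simp only [h2] at h
  simpa [dotProduct, partials, mul_comm] using h

theorem ContDiffOn.partials {B : (Fin n → ℝ) → ℝ} {U : Set (Fin n → ℝ)}
    (hB : ContDiffOn ℝ ∞ B U) (hU : IsOpen U) : ContDiffOn ℝ ∞ (partials B) U := by
  rw [contDiffOn_pi]
  intro i
  exact (hB.fderiv_of_isOpen hU le_rfl).clm_apply contDiffOn_const

theorem AnalyticOnNhd.partials {B : (Fin n → ℝ) → ℝ} {U : Set (Fin n → ℝ)}
    (hB : AnalyticOnNhd ℝ B U) : AnalyticOnNhd ℝ (partials B) U := by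
  intro u hu
  rw [analyticAt_pi_iff]
  intro i
  exact ((ContinuousLinearMap.apply ℝ ℝ (Pi.single i (1 : ℝ) : Fin n → ℝ)).analyticAt _).comp
    (hB.fderiv u hu)

theorem ContDiffOn.hasFDerivAt_of_isOpen {E F : Type*} [NormedAddCommGroup E] [NormedSpace ℝ E]
    [NormedAddCommGroup F] [NormedSpace ℝ F] {g : E → F} {U : Set E} {x : E}
    (hg : ContDiffOn ℝ ∞ g U) (hU : IsOpen U) (hx : x ∈ U) : HasFDerivAt g (fderiv ℝ g x) x :=
  ((hg.contDiffAt (hU.mem_nhds hx)).differentiableAt (by simp)).hasFDerivAt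

theorem ContDiffOn.dotProduct {E : Type*} [NormedAddCommGroup E] [NormedSpace ℝ E]
    {g G : E → (Fin n → ℝ)} {U : Set E}
    (hg : ContDiffOn ℝ ∞ g U) (hG : ContDiffOn ℝ ∞ G U) :
    ContDiffOn ℝ ∞ (fun u => g u ⬝ᵥ G u) U :=
  ContDiffOn.sum fun i _ => (contDiffOn_pi.1 hg i).mul (contDiffOn_pi.1 hG i)

theorem AnalyticAt.dotProduct {E : Type*} [NormedAddCommGroup E] [NormedSpace ℝ E]
    {g G : E → (Fin n → ℝ)} {u : E}
    (hg : AnalyticAt ℝ g u) (hG : AnalyticAt ℝ G u) :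
    AnalyticAt ℝ (fun u => g u ⬝ᵥ G u) u :=
  Finset.analyticAt_fun_sum _ fun i _ => (analyticAt_pi_iff.1 hg i).mul (analyticAt_pi_iff.1 hG i)

theorem fderiv_rulingPoint_eq {P R : (Fin n → ℝ) → HomCoord n}
    {P' R' : (Fin n → ℝ) →L[ℝ] HomCoord n} {q : (Fin n → ℝ) × ℝ × ℝ}
    (hP : HasFDerivAt P P' q.1) (hR : HasFDerivAt R R' q.1) :
    fderiv ℝ (rulingPoint P R) q = fun v : (Fin n → ℝ) × ℝ × ℝ =>
      (q.2.1 • P' v.1 + q.2.2 • R' v.1) + (v.2.1 • P q.1 + v.2.2 • R q.1) := by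
  have h1 : HasFDerivAt (fun q : (Fin n → ℝ) × ℝ × ℝ => P q.1) _ q := hP.comp q hasFDerivAt_fst
  have h2 : HasFDerivAt (fun q : (Fin n → ℝ) × ℝ × ℝ => R q.1) _ q := hR.comp q hasFDerivAt_fst
  have h3 : HasFDerivAt (Prod.snd : (Fin n → ℝ) × ℝ × ℝ → ℝ × ℝ)
      (ContinuousLinearMap.snd ℝ (Fin n → ℝ) (ℝ × ℝ)) q := hasFDerivAt_snd
  have hs := h3.fst
  have ht := h3.snd
  have h : HasFDerivAt (rulingPoint P R) _ q := (hs.smul h1).add (ht.smul h2)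
  rw [h.fderiv]
  ext1 v
  simp only [_root_.add_apply, _root_.smul_apply,
    ContinuousLinearMap.comp_apply, ContinuousLinearMap.smulRight_apply,
    ContinuousLinearMap.coe_fst', ContinuousLinearMap.coe_snd']
  abel

end Calculus

/-! ### Tangential lifts and the incidence form. -/

section Lifts

variable {n : ℕ}

/-- The map `w ↦ (0, w, b ⬝ᵥ w, c ⬝ᵥ w, 0)`. -/
def primalLift (b c : Fin n → ℝ) : (Fin n → ℝ) →L[ℝ] HomCoord n :=
  (0 : (Fin n → ℝ) →L[ℝ] ℝ).prod ((ContinuousLinearMap.id ℝ _).prod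
    ((dotCLM b).prod ((dotCLM c).prod 0)))

/-- The map `w ↦ (u ⬝ᵥ w, -w, 0, 0, f ⬝ᵥ w)`. -/
def dualLift (u f : Fin n → ℝ) : (Fin n → ℝ) →L[ℝ] HomCoord n :=
  (dotCLM u).prod ((-ContinuousLinearMap.id ℝ _).prod
    ((0 : (Fin n → ℝ) →L[ℝ] ℝ).prod ((0 : (Fin n → ℝ) →L[ℝ] ℝ).prod (dotCLM f))))

theorem primalLift_apply (b c w : Fin n → ℝ) :
    primalLift b c w = (0, w, b ⬝ᵥ w, c ⬝ᵥ w, 0) := by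
  simp [primalLift]

theorem dualLift_apply (u f w : Fin n → ℝ) :
    dualLift u f w = (u ⬝ᵥ w, -w, 0, 0, f ⬝ᵥ w) := by
  simp [dualLift]

theorem incidence_comm (Z Y : HomCoord n) : incidence Z Y = incidence Y Z := by
  simp only [incidence, dotProduct_comm, mul_comm]

theorem incidence_add_right (Z Y Y' : HomCoord n) :
    incidence Z (Y + Y') = incidence Z Y + incidence Z Y' := by
  simp only [incidence, Prod.fst_add, Prod.snd_add, dotProduct_add]
  ring

theorem incidence_smul_right (c : ℝ) (Z Y : HomCoord n) :
    incidence Z (c • Y) = c * incidence Z Y := by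
  simp only [incidence, Prod.smul_fst, Prod.smul_snd, dotProduct_smul, smul_eq_mul]
  ring

theorem incidence_add_left (Z Z' Y : HomCoord n) :
    incidence (Z + Z') Y = incidence Z Y + incidence Z' Y := by
  simp only [incidence_comm _ Y, incidence_add_right]

theorem incidence_smul_left (c : ℝ) (Z Y : HomCoord n) :
    incidence (c • Z) Y = c * incidence Z Y := by
  simp only [incidence_comm _ Y, incidence_smul_right]

/-- The incidence pairing as a bilinear form. -/
def incidenceForm (n : ℕ) : LinearMap.BilinForm ℝ (HomCoord n) :=
  LinearMap.mk₂ ℝ incidence incidence_add_left incidence_smul_left incidence_add_right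
    incidence_smul_right

@[simp]
theorem incidenceForm_apply (Z Y : HomCoord n) : incidenceForm n Z Y = incidence Z Y := rfl

theorem eq_zero_of_incidence_eq_zero {Y : HomCoord n} (h : ∀ Z, incidence Z Y = 0) : Y = 0 := by
  -- Pairing `Y` with itself gives the sum of the squares of its coordinates.
  have hself := h Y
  simp only [incidence] at hself
  have h0 : 0 ≤ Y.2.1 ⬝ᵥ Y.2.1 := Finset.sum_nonneg fun i _ => mul_self_nonneg _
  have h1 := mul_self_nonneg Y.1
  have h2 := mul_self_nonneg Y.2.2.1
  have h3 := mul_self_nonneg Y.2.2.2.1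
  have h4 := mul_self_nonneg Y.2.2.2.2
  have e0 : Y.2.1 = 0 := dotProduct_self_eq_zero.1 (by linarith)
  have e1 : Y.1 = 0 := mul_self_eq_zero.1 (by linarith)
  have e2 : Y.2.2.1 = 0 := mul_self_eq_zero.1 (by linarith)
  have e3 : Y.2.2.2.1 = 0 := mul_self_eq_zero.1 (by linarith)
  have e4 : Y.2.2.2.2 = 0 := mul_self_eq_zero.1 (by linarith)
  ext <;> simp [*]

theorem incidenceForm_nondegenerate : (incidenceForm n).Nondegenerate := by
  refine ⟨fun Z hZ => eq_zero_of_incidence_eq_zero fun Y => ?_,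
    fun Y hY => eq_zero_of_incidence_eq_zero hY⟩
  rw [incidence_comm]
  exact hZ Y

theorem mem_generator_iff {P R : (Fin n → ℝ) → HomCoord n} {u : Fin n → ℝ} {Y : HomCoord n} :
    Y ∈ generator P R u ↔ ∃ a b : ℝ, a • P u + b • R u = Y :=
  Submodule.mem_span_pair

end Lifts

/-! ### Tangent spaces of the hypersurface and of its dual. -/

namespace ConsSystem

variable {n : ℕ} {S : ConsSystem n} {U : Set (Fin n → ℝ)} {u : Fin n → ℝ}

theorem HasTwoLaws.mono (hS : S.HasTwoLaws U) {W : Set (Fin n → ℝ)} (hW : IsOpen W)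
    (hWU : W ⊆ U) : S.HasTwoLaws W where
  isOpen := hW
  smooth_f := hS.smooth_f.mono hWU
  smooth_B := hS.smooth_B.mono hWU
  smooth_A := hS.smooth_A.mono hWU
  smooth_N := hS.smooth_N.mono hWU
  smooth_M := hS.smooth_M.mono hWU
  law_BA u hu := hS.law_BA u (hWU hu)
  law_NM u hu := hS.law_NM u (hWU hu)

/-- The pencil whose invertibility at `(u, s, t)` characterizes the regular points. -/
def primalPencil (S : ConsSystem n) (q : (Fin n → ℝ) × ℝ × ℝ) : (Fin n → ℝ) →L[ℝ] (Fin n → ℝ) :=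
  q.2.1 • ContinuousLinearMap.id ℝ _ + q.2.2 • fderiv ℝ S.f q.1

/-- The pencil of Hessians whose invertibility characterizes the regular points of the dual. -/
def dualPencil (S : ConsSystem n) (q : (Fin n → ℝ) × ℝ × ℝ) : (Fin n → ℝ) →L[ℝ] (Fin n → ℝ) :=
  q.2.1 • fderiv ℝ (partials S.B) q.1 + q.2.2 • fderiv ℝ (partials S.N) q.1

theorem _root_.IsConservationLaw.fderiv_eq {f : (Fin n → ℝ) → (Fin n → ℝ)}
    {B A : (Fin n → ℝ) → ℝ} (h : IsConservationLaw f U B A) (hu : u ∈ U) :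
    fderiv ℝ A u = (dotCLM (partials B u)).comp (fderiv ℝ f u) := by
  ext1 w
  rw [← h u hu w _ rfl, fderiv_eq_dotCLM_partials]
  rfl

theorem HasTwoLaws.hasFDerivAt_p (hS : S.HasTwoLaws U) (hu : u ∈ U) :
    HasFDerivAt S.p (primalLift (partials S.B u) (partials S.N u)) u := by
  have hB := hS.smooth_B.hasFDerivAt_of_isOpen hS.isOpen hu
  have hN := hS.smooth_N.hasFDerivAt_of_isOpen hS.isOpen hu
  rw [fderiv_eq_dotCLM_partials] at hB hN
  exact (hasFDerivAt_const _ _).prodMk ((hasFDerivAt_id u).prodMk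
    (hB.prodMk (hN.prodMk (hasFDerivAt_const _ _))))

/-- The two conservation laws are what makes the derivative of `r` factor through that of `p`. -/
theorem HasTwoLaws.hasFDerivAt_r (hS : S.HasTwoLaws U) (hu : u ∈ U) :
    HasFDerivAt S.r ((primalLift (partials S.B u) (partials S.N u)).comp (fderiv ℝ S.f u)) u := by
  have hA := hS.smooth_A.hasFDerivAt_of_isOpen hS.isOpen hu
  have hM := hS.smooth_M.hasFDerivAt_of_isOpen hS.isOpen hu
  rw [hS.law_BA.fderiv_eq hu] at hA
  rw [hS.law_NM.fderiv_eq hu] at hM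
  have h := (hasFDerivAt_const (0 : ℝ) u).prodMk
    ((hS.smooth_f.hasFDerivAt_of_isOpen hS.isOpen hu).prodMk
      (hA.prodMk (hM.prodMk (hasFDerivAt_const (1 : ℝ) u))))
  exact h

/-- The product rule term `B_i du^i` cancels against `dB`, leaving only the Hessian. -/
theorem hasFDerivAt_legendre {B : (Fin n → ℝ) → ℝ} (hU : IsOpen U) (hB : ContDiffOn ℝ ∞ B U)
    (hu : u ∈ U) :
    HasFDerivAt (fun u => u ⬝ᵥ partials B u - B u)
      ((dotCLM u).comp (fderiv ℝ (partials B) u)) u := by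
  have h1 := hB.hasFDerivAt_of_isOpen hU hu
  rw [fderiv_eq_dotCLM_partials] at h1
  refine (((hasFDerivAt_id u).dotProduct
    ((hB.partials hU).hasFDerivAt_of_isOpen hU hu)).sub h1).congr_fderiv ?_
  ext1 w
  simp

/-- Here the term `B_i df^i` cancels against `dA`, which is exactly the conservation law. -/
theorem hasFDerivAt_legendre_flux {f : (Fin n → ℝ) → (Fin n → ℝ)} {B A : (Fin n → ℝ) → ℝ}
    (hU : IsOpen U) (hf : ContDiffOn ℝ ∞ f U) (hB : ContDiffOn ℝ ∞ B U) (hA : ContDiffOn ℝ ∞ A U)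
    (hlaw : IsConservationLaw f U B A) (hu : u ∈ U) :
    HasFDerivAt (fun u => f u ⬝ᵥ partials B u - A u)
      ((dotCLM (f u)).comp (fderiv ℝ (partials B) u)) u := by
  have h1 := hA.hasFDerivAt_of_isOpen hU hu
  rw [hlaw.fderiv_eq hu] at h1
  refine (((hf.hasFDerivAt_of_isOpen hU hu).dotProduct
    ((hB.partials hU).hasFDerivAt_of_isOpen hU hu)).sub h1).congr_fderiv ?_
  ext1 w
  simp

theorem HasTwoLaws.hasFDerivAt_dualP (hS : S.HasTwoLaws U) (hu : u ∈ U) :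
    HasFDerivAt S.dualP ((dualLift u (S.f u)).comp (fderiv ℝ (partials S.B) u)) u := by
  have h := (hasFDerivAt_legendre hS.isOpen hS.smooth_B hu).prodMk
    (((hS.smooth_B.partials hS.isOpen).hasFDerivAt_of_isOpen hS.isOpen hu).neg.prodMk
      ((hasFDerivAt_const (1 : ℝ) u).prodMk ((hasFDerivAt_const (0 : ℝ) u).prodMk
        (hasFDerivAt_legendre_flux hS.isOpen hS.smooth_f hS.smooth_B hS.smooth_A hS.law_BA hu))))
  refine h.congr_fderiv ?_
  ext1 w
  simp [dualLift]

theorem HasTwoLaws.hasFDerivAt_dualR (hS : S.HasTwoLaws U) (hu : u ∈ U) :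
    HasFDerivAt S.dualR ((dualLift u (S.f u)).comp (fderiv ℝ (partials S.N) u)) u := by
  have h := (hasFDerivAt_legendre hS.isOpen hS.smooth_N hu).prodMk
    (((hS.smooth_N.partials hS.isOpen).hasFDerivAt_of_isOpen hS.isOpen hu).neg.prodMk
      ((hasFDerivAt_const (0 : ℝ) u).prodMk ((hasFDerivAt_const (1 : ℝ) u).prodMk
        (hasFDerivAt_legendre_flux hS.isOpen hS.smooth_f hS.smooth_N hS.smooth_M hS.law_NM hu))))
  refine h.congr_fderiv ?_
  ext1 w
  simp [dualLift]

theorem HasTwoLaws.fderiv_rulingPoint (hS : S.HasTwoLaws U) {q : (Fin n → ℝ) × ℝ × ℝ}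
    (hq : q.1 ∈ U) (v : (Fin n → ℝ) × ℝ × ℝ) :
    fderiv ℝ (rulingPoint S.p S.r) q v =
      primalLift (partials S.B q.1) (partials S.N q.1) (S.primalPencil q v.1) +
        (v.2.1 • S.p q.1 + v.2.2 • S.r q.1) := by
  rw [fderiv_rulingPoint_eq (hS.hasFDerivAt_p hq) (hS.hasFDerivAt_r hq)]
  simp [primalPencil]

theorem HasTwoLaws.fderiv_rulingPoint_dual (hS : S.HasTwoLaws U) {q : (Fin n → ℝ) × ℝ × ℝ}
    (hq : q.1 ∈ U) (v : (Fin n → ℝ) × ℝ × ℝ) :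
    fderiv ℝ (rulingPoint S.dualP S.dualR) q v =
      dualLift q.1 (S.f q.1) (S.dualPencil q v.1) +
        (v.2.1 • S.dualP q.1 + v.2.2 • S.dualR q.1) := by
  rw [fderiv_rulingPoint_eq (hS.hasFDerivAt_dualP hq) (hS.hasFDerivAt_dualR hq)]
  simp [dualPencil]

/-- The first and last coordinates see only the coefficients of `p` and `r`, so these vanish on a
kernel vector; the lift itself is injective. -/
theorem HasTwoLaws.isRegularAt_iff (hS : S.HasTwoLaws U) {q : (Fin n → ℝ) × ℝ × ℝ}
    (hq : q.1 ∈ U) : IsRegularAt S.p S.r q ↔ Function.Injective (S.primalPencil q) := by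
  rw [IsRegularAt, injective_iff_map_eq_zero, injective_iff_map_eq_zero]
  simp only [hS.fderiv_rulingPoint hq]
  constructor
  · intro h w hw
    have := h (w, 0, 0) (by simp [hw])
    exact congrArg Prod.fst this
  · intro h v hv
    simp only [primalLift_apply, p, r, Prod.ext_iff, Prod.fst_add, Prod.snd_add, Prod.smul_fst,
      Prod.smul_snd, smul_eq_mul, Prod.fst_zero, Prod.snd_zero] at hv
    obtain ⟨h0, h1, -, -, h4⟩ := hv
    have h0 : v.2.1 = 0 := by simpa using h0
    have h4 : v.2.2 = 0 := by simpa using h4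
    have h1 : v.1 = 0 := h _ (by simpa [h0, h4] using h1)
    ext <;> simp [*]

/-- As for the primal family, with the coordinates `Z_{n+1}`, `Z_{n+2}` reading off the coefficients
of `dualP` and `dualR`. -/
theorem HasTwoLaws.isRegularAt_dual_iff (hS : S.HasTwoLaws U) {q : (Fin n → ℝ) × ℝ × ℝ}
    (hq : q.1 ∈ U) : IsRegularAt S.dualP S.dualR q ↔ Function.Injective (S.dualPencil q) := by
  rw [IsRegularAt, injective_iff_map_eq_zero, injective_iff_map_eq_zero]
  simp only [hS.fderiv_rulingPoint_dual hq]
  constructor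
  · intro h w hw
    have := h (w, 0, 0) (by simp [hw])
    exact congrArg Prod.fst this
  · intro h v hv
    simp only [dualLift_apply, dualP, dualR, Prod.ext_iff, Prod.fst_add, Prod.snd_add,
      Prod.smul_fst, Prod.smul_snd, smul_eq_mul, Prod.fst_zero, Prod.snd_zero] at hv
    obtain ⟨-, h1, h2, h3, -⟩ := hv
    have h2 : v.2.1 = 0 := by simpa using h2
    have h3 : v.2.2 = 0 := by simpa using h3
    have h1 : v.1 = 0 := h _ (by simpa [h2, h3] using h1)
    ext <;> simp [*]

/-- At the point `p(u)` the pencil is the identity, so every generator carries a regular point. -/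
theorem isRegularAt_one_zero (hS : S.HasTwoLaws U) (hu : u ∈ U) :
    ((u, 1, 0) : (Fin n → ℝ) × ℝ × ℝ) ∈ regularSet S.p S.r U := by
  refine ⟨hu, (hS.isRegularAt_iff hu).2 ?_⟩
  simp [primalPencil, Function.Injective]

theorem incidence_dualP_p : incidence (S.dualP u) (S.p u) = 0 := by
  simp [incidence, dualP, p, dotProduct_comm u]
  ring

theorem incidence_dualP_r : incidence (S.dualP u) (S.r u) = 0 := by
  simp [incidence, dualP, r, dotProduct_comm (S.f u)]

theorem incidence_dualR_p : incidence (S.dualR u) (S.p u) = 0 := by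
  simp [incidence, dualR, p, dotProduct_comm u]
  ring

theorem incidence_dualR_r : incidence (S.dualR u) (S.r u) = 0 := by
  simp [incidence, dualR, r, dotProduct_comm (S.f u)]

theorem incidence_dualP_primalLift (w : Fin n → ℝ) :
    incidence (S.dualP u) (primalLift (partials S.B u) (partials S.N u) w) = 0 := by
  simp [incidence, dualP, primalLift_apply]

theorem incidence_dualR_primalLift (w : Fin n → ℝ) :
    incidence (S.dualR u) (primalLift (partials S.B u) (partials S.N u) w) = 0 := by
  simp [incidence, dualR, primalLift_apply]

theorem incidence_dualLift_p (w : Fin n → ℝ) :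
    incidence (dualLift u (S.f u) w) (S.p u) = 0 := by
  simp [incidence, dualLift_apply, p, dotProduct_comm u]

theorem incidence_dualLift_r (w : Fin n → ℝ) :
    incidence (dualLift u (S.f u) w) (S.r u) = 0 := by
  simp [incidence, dualLift_apply, r, dotProduct_comm (S.f u)]

theorem _root_.surjective_of_injective_pi {Λ : (Fin n → ℝ) →L[ℝ] (Fin n → ℝ)}
    (h : Function.Injective Λ) : Function.Surjective Λ :=
  LinearMap.surjective_of_injective (f := (Λ : (Fin n → ℝ) →ₗ[ℝ] (Fin n → ℝ))) h

theorem mem_projTangent_iff (hS : S.HasTwoLaws U) {q : (Fin n → ℝ) × ℝ × ℝ}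
    (hq : q ∈ regularSet S.p S.r U) {Y : HomCoord n} :
    Y ∈ projTangent S.p S.r q ↔
      incidence (S.dualP q.1) Y = 0 ∧ incidence (S.dualR q.1) Y = 0 := by
  constructor
  · rintro ⟨v, rfl⟩
    change incidence _ (fderiv ℝ (rulingPoint S.p S.r) q v) = 0 ∧
      incidence _ (fderiv ℝ (rulingPoint S.p S.r) q v) = 0
    rw [hS.fderiv_rulingPoint hq.1]
    simp only [incidence_add_right, incidence_smul_right, incidence_dualP_p, incidence_dualP_r,
      incidence_dualR_p, incidence_dualR_r, incidence_dualP_primalLift, incidence_dualR_primalLift]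
    simp
  · rintro ⟨h1, h2⟩
    -- The first and last coordinates of `Y` fix the coefficients of `p` and `r`, the invertible
    -- pencil solves the middle block, and the two incidences force the remaining coordinates.
    obtain ⟨w, hw⟩ := surjective_of_injective_pi ((hS.isRegularAt_iff hq.1).1 hq.2)
      (Y.2.1 - Y.1 • q.1 - Y.2.2.2.2 • S.f q.1)
    refine ⟨(w, Y.1, Y.2.2.2.2), ?_⟩
    change fderiv ℝ (rulingPoint S.p S.r) q (w, Y.1, Y.2.2.2.2) = Y
    rw [hS.fderiv_rulingPoint hq.1]
    simp only [hw]
    simp only [incidence, dualP, dualR, neg_dotProduct] at h1 h2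
    obtain ⟨y0, yv, yb, yn, y3⟩ := Y
    simp only [primalLift_apply, p, r, dotProduct_sub, dotProduct_smul, smul_eq_mul] at h1 h2 ⊢
    rw [dotProduct_comm q.1, dotProduct_comm (S.f q.1)] at h1 h2
    simp only [Prod.ext_iff, Prod.fst_add, Prod.snd_add, Prod.smul_fst,
      Prod.smul_snd, smul_eq_mul]
    refine ⟨by ring, ?_, by linarith, by linarith, by ring⟩
    abel

theorem incidence_projTangent_eq_zero_iff (hS : S.HasTwoLaws U) {q : (Fin n → ℝ) × ℝ × ℝ}
    (hq : q ∈ regularSet S.p S.r U) (Z : HomCoord n) :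
    (∀ Y ∈ projTangent S.p S.r q, incidence Z Y = 0) ↔ Z ∈ generator S.dualP S.dualR q.1 := by
  rw [mem_generator_iff]
  constructor
  · intro h
    have hp := h (S.p q.1) ((mem_projTangent_iff hS hq).2 ⟨incidence_dualP_p, incidence_dualR_p⟩)
    have hr := h (S.r q.1) ((mem_projTangent_iff hS hq).2 ⟨incidence_dualP_r, incidence_dualR_r⟩)
    -- Testing on the lifts determines the `Z_i` from `Z_{n+1}` and `Z_{n+2}`; testing on `p` and
    -- `r` then determines `Z_0` and `Z_{n+3}`.
    have hl := fun w => h _ ((mem_projTangent_iff hS hq).2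
      ⟨incidence_dualP_primalLift w, incidence_dualR_primalLift w⟩)
    obtain ⟨z0, zv, zb, zn, z3⟩ := Z
    simp only [incidence, p, r, primalLift_apply] at hp hr hl
    have hzv : zv = -(zb • partials S.B q.1 + zn • partials S.N q.1) := by
      rw [eq_neg_iff_add_eq_zero]
      refine dotProduct_eq_zero _ fun w => ?_
      simp only [add_dotProduct, smul_dotProduct, smul_eq_mul]
      linarith [hl w]
    subst hzv
    simp only [neg_dotProduct, add_dotProduct, smul_dotProduct, smul_eq_mul] at hp hr
    rw [dotProduct_comm _ q.1, dotProduct_comm _ q.1] at hp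
    rw [dotProduct_comm _ (S.f q.1), dotProduct_comm _ (S.f q.1)] at hr
    refine ⟨zb, zn, ?_⟩
    simp only [dualP, dualR, Prod.ext_iff, Prod.fst_add, Prod.snd_add, Prod.smul_fst,
      Prod.smul_snd, smul_eq_mul]
    refine ⟨by linarith, ?_, by ring, by ring, by linarith⟩
    simp only [smul_neg, neg_add]
  · rintro ⟨a, b, rfl⟩ Y hY
    obtain ⟨h1, h2⟩ := (mem_projTangent_iff hS hq).1 hY
    rw [incidence_add_left, incidence_smul_left, incidence_smul_left, h1, h2]
    simp

/-- This inclusion needs no regularity, which is what allows its use where the dual parametrization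
degenerates. -/
theorem incidence_eq_zero_of_mem_projTangent_dual (hS : S.HasTwoLaws U)
    {q : (Fin n → ℝ) × ℝ × ℝ} (hq : q.1 ∈ U) {Z : HomCoord n}
    (hZ : Z ∈ projTangent S.dualP S.dualR q) :
    incidence Z (S.p q.1) = 0 ∧ incidence Z (S.r q.1) = 0 := by
  obtain ⟨v, rfl⟩ := hZ
  change incidence (fderiv ℝ (rulingPoint S.dualP S.dualR) q v) _ = 0 ∧
    incidence (fderiv ℝ (rulingPoint S.dualP S.dualR) q v) _ = 0
  rw [hS.fderiv_rulingPoint_dual hq]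
  simp only [incidence_add_left, incidence_smul_left, incidence_dualP_p, incidence_dualP_r,
    incidence_dualR_p, incidence_dualR_r, incidence_dualLift_p, incidence_dualLift_r]
  simp

theorem mem_projTangent_dual_iff (hS : S.HasTwoLaws U) {q : (Fin n → ℝ) × ℝ × ℝ}
    (hq : q ∈ regularSet S.dualP S.dualR U) {Z : HomCoord n} :
    Z ∈ projTangent S.dualP S.dualR q ↔
      incidence Z (S.p q.1) = 0 ∧ incidence Z (S.r q.1) = 0 := by
  refine ⟨incidence_eq_zero_of_mem_projTangent_dual hS hq.1, ?_⟩
  rintro ⟨h1, h2⟩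
  obtain ⟨w, hw⟩ := surjective_of_injective_pi ((hS.isRegularAt_dual_iff hq.1).1 hq.2)
    (-(Z.2.1 + Z.2.2.1 • partials S.B q.1 + Z.2.2.2.1 • partials S.N q.1))
  refine ⟨(w, Z.2.2.1, Z.2.2.2.1), ?_⟩
  change fderiv ℝ (rulingPoint S.dualP S.dualR) q (w, Z.2.2.1, Z.2.2.2.1) = Z
  rw [hS.fderiv_rulingPoint_dual hq.1]
  simp only [hw]
  obtain ⟨z0, zv, zb, zn, z3⟩ := Z
  simp only [incidence, p, r] at h1 h2
  rw [dotProduct_comm zv] at h1 h2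
  simp only [dualLift_apply, dualP, dualR, dotProduct_neg, dotProduct_add, dotProduct_smul,
    smul_eq_mul, Prod.ext_iff, Prod.fst_add, Prod.snd_add, Prod.smul_fst,
    Prod.smul_snd]
  refine ⟨by linarith, ?_, by ring, by ring, by linarith⟩
  simp only [smul_neg, neg_neg]
  abel

theorem tangentsStable_dual (hS : S.HasTwoLaws U) : TangentsStable S.dualP S.dualR U := by
  intro q hq q' hq' h
  ext Z
  rw [mem_projTangent_dual_iff hS hq, mem_projTangent_dual_iff hS hq', h]

theorem dualSet_eq_ruledSet (hS : S.HasTwoLaws U) :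
    dualSet S.p S.r U = ruledSet S.dualP S.dualR U := by
  ext z
  constructor
  · rintro ⟨q, hq, h⟩
    exact ⟨q.1, hq.1, fun Z hZ => (incidence_projTangent_eq_zero_iff hS hq Z).1 (h Z hZ)⟩
  · rintro ⟨u, hu, h⟩
    exact ⟨(u, 1, 0), isRegularAt_one_zero hS hu, fun Z hZ =>
      (incidence_projTangent_eq_zero_iff hS (isRegularAt_one_zero hS hu) Z).2 (h hZ)⟩

theorem tangentsConcurrent_of_incidence (hS : S.HasTwoLaws U) {y : HomCoord n} (hy : y ≠ 0)
    (h : ∀ u ∈ U, incidence (S.dualP u) y = 0 ∧ incidence (S.dualR u) y = 0) :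
    TangentsConcurrent S.p S.r U :=
  ⟨y, hy, fun q hq => (mem_projTangent_iff hS hq).2 (h q.1 hq.1)⟩

/-- A proper span has a nonzero orthogonal vector for the nondegenerate incidence form, and that
vector lies in every tangent space of the primal family. -/
theorem span_dualSet_eq_top (hS : S.HasTwoLaws U) (hconc : ¬ TangentsConcurrent S.p S.r U) :
    Projectivization.Subspace.span (dualSet S.p S.r U) = ⊤ := by
  by_contra hne
  set W := Projectivization.Subspace.span (dualSet S.p S.r U) with hW
  have hlt : Projectivization.Subspace.submodule W < ⊤ := by
    refine lt_top_iff_ne_top.2 fun h => hne ?_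
    rw [← map_top Projectivization.Subspace.submodule] at h
    exact Projectivization.Subspace.submodule.injective h
  have hmem : ∀ u ∈ U, ∀ Z ∈ generator S.dualP S.dualR u,
      Z ∈ Projectivization.Subspace.submodule W := by
    intro u hu Z hZ
    by_cases h0 : Z = 0
    · rw [h0]
      exact Submodule.zero_mem _
    · rw [Projectivization.Subspace.mem_submodule_iff _ h0]
      refine Projectivization.Subspace.subset_span _ ?_
      rw [dualSet_eq_ruledSet hS]
      refine ⟨u, hu, ?_⟩
      rw [Projectivization.submodule_mk, Submodule.span_singleton_le_iff_mem]
      exact hZ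
  have horth : (incidenceForm n).orthogonal (Projectivization.Subspace.submodule W) ≠ ⊥ := by
    intro h
    have h1 := LinearMap.BilinForm.finrank_orthogonal (incidenceForm_nondegenerate (n := n))
      (Projectivization.Subspace.submodule W)
    rw [h, finrank_bot] at h1
    have := Submodule.finrank_lt hlt.ne
    omega
  obtain ⟨y, hy, hy0⟩ := Submodule.exists_mem_ne_zero_of_ne_bot horth
  refine hconc (tangentsConcurrent_of_incidence hS hy0 fun u hu => ⟨?_, ?_⟩)
  · exact hy _ (hmem u hu _ (Submodule.subset_span (by simp)))
  · exact hy _ (hmem u hu _ (Submodule.subset_span (by simp)))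

end ConsSystem

/-! ### Density of regular parameters and points of locally constant rank. -/

/-- A pencil of endomorphisms. -/
def pencil {n : ℕ} (X Y : (Fin n → ℝ) →L[ℝ] (Fin n → ℝ)) (c : ℝ × ℝ) :
    (Fin n → ℝ) →L[ℝ] (Fin n → ℝ) :=
  c.1 • X + c.2 • Y

/-- If over a dense set of parameters some member of the pencil is injective, then the parameters
of the injective members are dense. -/
theorem subset_closure_of_pencil {n : ℕ} {U : Set (Fin n → ℝ)} (hU : IsOpen U)
    {G : Set ((Fin n → ℝ) × ℝ × ℝ)}
    (h : ∀ W ⊆ U, IsOpen W → W.Nonempty → ∃ u ∈ W, ∃ X Y : (Fin n → ℝ) →L[ℝ] (Fin n → ℝ),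
      (∃ c, Function.Injective (pencil X Y c)) ∧
        ∀ c, Function.Injective (pencil X Y c) → (u, c) ∈ G) :
    U ×ˢ Set.univ ⊆ closure G := by
  rintro ⟨u, c⟩ ⟨hu, -⟩
  rw [mem_closure_iff_nhds]
  intro o ho
  rw [nhds_prod_eq, Filter.mem_prod_iff] at ho
  obtain ⟨W, hW, C, hC, hWC⟩ := ho
  obtain ⟨W', hW'W, hW'o, huW'⟩ := mem_nhds_iff.1 (Filter.inter_mem hW (hU.mem_nhds hu))
  obtain ⟨u', hu', X, Y, ⟨c₀, hc₀⟩, hG⟩ := h W' (fun x hx => (hW'W hx).2) hW'o ⟨u, huW'⟩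
  -- For fixed `u` the pencil is linear in `c`, hence analytic on the plane, whatever the smoothness
  -- in `u`.
  have han : AnalyticOnNhd ℝ (pencil X Y) Set.univ := fun c _ =>
    (analyticAt_fst.smul analyticAt_const).add (analyticAt_snd.smul analyticAt_const)
  have hcl := subset_closure_setOf_injective isOpen_univ isPreconnected_univ han
    (Set.mem_univ c₀) hc₀ (Set.mem_univ c)
  obtain ⟨c', hc'C, -, hc'⟩ := mem_closure_iff_nhds.1 hcl C hC
  exact ⟨(u', c'), hWC ⟨(hW'W hu').1, hc'C⟩, hG c' hc'⟩

theorem ContDiffOn.rulingPoint {n : ℕ} {P R : (Fin n → ℝ) → HomCoord n} {U : Set (Fin n → ℝ)}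
    (hP : ContDiffOn ℝ ∞ P U) (hR : ContDiffOn ℝ ∞ R U) :
    ContDiffOn ℝ ∞ (rulingPoint P R) (U ×ˢ Set.univ) := by
  have h1 : ContDiffOn ℝ ∞ (fun q : (Fin n → ℝ) × ℝ × ℝ => P q.1) (U ×ˢ Set.univ) :=
    hP.comp contDiffOn_fst fun q hq => hq.1
  have h2 : ContDiffOn ℝ ∞ (fun q : (Fin n → ℝ) × ℝ × ℝ => R q.1) (U ×ˢ Set.univ) :=
    hR.comp contDiffOn_fst fun q hq => hq.1
  have hs : ContDiff ℝ ∞ (fun q : (Fin n → ℝ) × ℝ × ℝ => q.2.1) := by fun_prop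
  have ht : ContDiff ℝ ∞ (fun q : (Fin n → ℝ) × ℝ × ℝ => q.2.2) := by fun_prop
  exact (hs.contDiffOn.smul h1).add (ht.contDiffOn.smul h2)

/-- Points at which the rank of a continuous family of linear maps is locally constant exist in
every nonempty open set. -/
theorem exists_eventually_finrank_range_eq {X E F : Type*} [TopologicalSpace X]
    [NormedAddCommGroup E] [NormedSpace ℝ E] [NormedAddCommGroup F] [NormedSpace ℝ F]
    [FiniteDimensional ℝ E] [FiniteDimensional ℝ F] {O : Set X} (hO : IsOpen O)
    (hne : O.Nonempty) {A : X → E →L[ℝ] F} (hA : ContinuousOn A O) :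
    ∃ x ∈ O, ∀ᶠ y in 𝓝 x, Module.finrank ℝ (LinearMap.range (A y : E →ₗ[ℝ] F)) =
      Module.finrank ℝ (LinearMap.range (A x : E →ₗ[ℝ] F)) := by
  set rk : X → ℕ := fun x => Module.finrank ℝ (LinearMap.range (A x : E →ₗ[ℝ] F)) with hrk
  have hbdd : BddAbove (rk '' O) :=
    ⟨Module.finrank ℝ F, by rintro _ ⟨x, -, rfl⟩; exact Submodule.finrank_le _⟩
  -- At a point of maximal rank, lower semicontinuity makes the rank locally constant.
  obtain ⟨x, hx, hmax⟩ := Nat.sSup_mem (hne.image rk) hbdd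
  refine ⟨x, hx, ?_⟩
  filter_upwards [hO.mem_nhds hx, (hA.continuousAt (hO.mem_nhds hx)).eventually
    (eventually_finrank_range_le (A x))] with y hyO hy
  refine le_antisymm ?_ hy
  change rk y ≤ rk x
  rw [hmax]
  exact le_csSup hbdd ⟨y, hyO, rfl⟩

/-! ### Codimension two of the dual. -/

namespace ConsSystem

variable {n : ℕ} {S : ConsSystem n} {U : Set (Fin n → ℝ)} {u : Fin n → ℝ}

theorem HasTwoLaws.contDiffOn_p (hS : S.HasTwoLaws U) : ContDiffOn ℝ ∞ S.p U :=
  contDiffOn_const.prodMk (contDiffOn_id.prodMk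
    (hS.smooth_B.prodMk (hS.smooth_N.prodMk contDiffOn_const)))

theorem HasTwoLaws.contDiffOn_r (hS : S.HasTwoLaws U) : ContDiffOn ℝ ∞ S.r U :=
  contDiffOn_const.prodMk (hS.smooth_f.prodMk
    (hS.smooth_A.prodMk (hS.smooth_M.prodMk contDiffOn_const)))

theorem HasTwoLaws.contDiffOn_dualP (hS : S.HasTwoLaws U) : ContDiffOn ℝ ∞ S.dualP U := by
  have h := hS.smooth_B.partials hS.isOpen
  exact ((contDiffOn_id.dotProduct h).sub hS.smooth_B).prodMk (h.neg.prodMk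
    (contDiffOn_const.prodMk (contDiffOn_const.prodMk
      ((hS.smooth_f.dotProduct h).sub hS.smooth_A))))

theorem HasTwoLaws.contDiffOn_dualR (hS : S.HasTwoLaws U) : ContDiffOn ℝ ∞ S.dualR U := by
  have h := hS.smooth_N.partials hS.isOpen
  exact ((contDiffOn_id.dotProduct h).sub hS.smooth_N).prodMk (h.neg.prodMk
    (contDiffOn_const.prodMk (contDiffOn_const.prodMk
      ((hS.smooth_f.dotProduct h).sub hS.smooth_M))))

/-- Near a point at which the derivative of the parametrization of the dual has locally constant
rank smaller than `n + 2`, the fibres of that parametrization sweep out projective subspaces. -/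
theorem HasTwoLaws.exists_subspace_of_rank_lt (hS : S.HasTwoLaws U) {c c₀ : ℝ × ℝ}
    (hq : (u, c) ∈ regularSet S.p S.r U) (hreg : ¬ IsRegularAt S.dualP S.dualR (u, c₀))
    (hrank : ∀ᶠ x in 𝓝 (u, c₀), Module.finrank ℝ (projTangent S.dualP S.dualR x) =
      Module.finrank ℝ (projTangent S.dualP S.dualR (u, c₀))) :
    ∃ L : Submodule ℝ (HomCoord n), Module.finrank ℝ L = 3 ∧ rulingPoint S.p S.r (u, c) ∈ L ∧
      ∀ᶠ y in 𝓝[(L : Set (HomCoord n))] (rulingPoint S.p S.r (u, c)),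
        ∀ hy : y ≠ 0, Projectivization.mk ℝ y hy ∈ ruledSet S.p S.r U := by
  have hu : u ∈ U := hq.1
  have hUO : U ×ˢ Set.univ ∈ 𝓝 ((u, c₀) : (Fin n → ℝ) × ℝ × ℝ) :=
    prod_mem_nhds (hS.isOpen.mem_nhds hu) Filter.univ_mem
  obtain ⟨O, hOsub, hO, hx₀O⟩ := mem_nhds_iff.1 (Filter.inter_mem hrank hUO)
  have hsmooth := hS.contDiffOn_dualP.rulingPoint hS.contDiffOn_dualR
  set D := fderiv ℝ (rulingPoint S.dualP S.dualR) (u, c₀) with hD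
  set K := LinearMap.ker (D : (Fin n → ℝ) × ℝ × ℝ →ₗ[ℝ] HomCoord n) with hK
  set R := LinearMap.range (D : (Fin n → ℝ) × ℝ × ℝ →ₗ[ℝ] HomCoord n) with hR
  obtain ⟨ψ, hψ0, hψd, hψ⟩ : ∃ ψ : K → (Fin n → ℝ) × ℝ × ℝ, ψ 0 = (u, c₀) ∧
      HasStrictFDerivAt ψ K.subtypeL 0 ∧ ∀ᶠ k in 𝓝 0, ψ k ∈ O ∧
        rulingPoint S.dualP S.dualR (ψ k) = rulingPoint S.dualP S.dualR (u, c₀) ∧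
        projTangent S.dualP S.dualR (ψ k) = R :=
    exists_fiber_parametrization hO
      ((hsmooth.mono fun x hx => (hOsub hx).2).of_le (by simp)) hx₀O fun x hx => (hOsub hx).1
  -- The tangent space `R` is the same along the whole fibre and annihilates each generator over it,
  -- so `L` contains all these generators.
  set L := (incidenceForm n).orthogonal R with hL
  have hdimH : Module.finrank ℝ (HomCoord n) = n + 4 := by
    simp only [Module.finrank_prod, Module.finrank_self, Module.finrank_fin_fun]
    omega
  have hdimL : Module.finrank ℝ L = Module.finrank ℝ (HomCoord n) - Module.finrank ℝ R :=
    LinearMap.BilinForm.finrank_orthogonal (incidenceForm_nondegenerate (n := n)) R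
  have hdimKR : Module.finrank ℝ R + Module.finrank ℝ K = n + 2 := by
    rw [hR, hK, LinearMap.finrank_range_add_finrank_ker]
    simp
  have hdimK : Module.finrank ℝ K ≠ 0 := by
    intro h0
    exact hreg (LinearMap.ker_eq_bot.1 (Submodule.finrank_eq_zero.1 h0))
  rw [hdimH] at hdimL
  -- the family of generators over the fibre
  set Θ : K × ℝ × ℝ → HomCoord n := fun v => rulingPoint S.p S.r ((ψ v.1).1, v.2) with hΘ
  have hΘ0 : Θ (0, c) = rulingPoint S.p S.r (u, c) := by simp [hΘ, hψ0]
  have hΘL : ∀ᶠ v in 𝓝 ((0, c) : K × ℝ × ℝ), Θ v ∈ L ∧ (ψ v.1).1 ∈ U := by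
    have h1 : Filter.Tendsto Prod.fst (𝓝 ((0, c) : K × ℝ × ℝ)) (𝓝 (0 : K)) :=
      continuous_fst.tendsto _
    filter_upwards [h1.eventually hψ] with v hv
    have hvU : (ψ v.1).1 ∈ U := (hOsub hv.1).2.1
    refine ⟨fun Z hZ => ?_, hvU⟩
    rw [← hv.2.2] at hZ
    obtain ⟨h1, h2⟩ := incidence_eq_zero_of_mem_projTangent_dual hS hvU hZ
    change incidence Z _ = 0
    simp only [hΘ, rulingPoint, incidence_add_right, incidence_smul_right, h1, h2]
    simp
  have hmemL : rulingPoint S.p S.r (u, c) ∈ L := by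
    rw [← hΘ0]
    exact hΘL.self_of_nhds.1
  set DF := fderiv ℝ (rulingPoint S.p S.r) (u, c) with hDF
  have hFd : HasStrictFDerivAt (rulingPoint S.p S.r) DF ((ψ (0 : K)).1, c) := by
    have h1 : ((ψ (0 : K)).1, c) = (u, c) := by rw [hψ0]
    rw [h1]
    exact ((hS.contDiffOn_p.rulingPoint hS.contDiffOn_r).contDiffAt
      (prod_mem_nhds (hS.isOpen.mem_nhds hu) Filter.univ_mem)).hasStrictFDerivAt (by simp)
  set m' : K × ℝ × ℝ →L[ℝ] (Fin n → ℝ) × ℝ × ℝ :=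
    (((ContinuousLinearMap.fst ℝ (Fin n → ℝ) (ℝ × ℝ)).comp K.subtypeL).comp
      (ContinuousLinearMap.fst ℝ K (ℝ × ℝ))).prod (ContinuousLinearMap.snd ℝ K (ℝ × ℝ)) with hm'
  have hmd : HasStrictFDerivAt
      (fun v : K × ℝ × ℝ => (((ψ v.1).1, v.2) : (Fin n → ℝ) × ℝ × ℝ)) m' (0, c) := by
    have h1 : HasStrictFDerivAt (fun v : K × ℝ × ℝ => ψ v.1)
        (K.subtypeL.comp (ContinuousLinearMap.fst ℝ K (ℝ × ℝ))) (0, c) :=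
      HasStrictFDerivAt.comp (f := Prod.fst) ((0, c) : K × ℝ × ℝ) hψd hasStrictFDerivAt_fst
    exact h1.fst.prodMk hasStrictFDerivAt_snd
  have hΘd : HasStrictFDerivAt Θ (DF.comp m') (0, c) :=
    HasStrictFDerivAt.comp ((0, c) : K × ℝ × ℝ) hFd hmd
  -- Composing with a projection onto `L` gives a map into `L` itself; it agrees with `Θ` near the
  -- base point, where `Θ` already takes values in `L`.
  obtain ⟨ρ, hρ⟩ : L.ClosedComplemented := .of_finiteDimensional L
  have hρΘd : HasStrictFDerivAt (fun v => ρ (Θ v)) (ρ.comp (DF.comp m')) (0, c) :=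
    ρ.hasStrictFDerivAt.comp ((0, c) : K × ℝ × ℝ) hΘd
  have hfix : L.subtypeL.comp (ρ.comp (DF.comp m')) = DF.comp m' := by
    have h1 : HasFDerivAt (fun v => L.subtypeL (ρ (Θ v)))
        (L.subtypeL.comp (ρ.comp (DF.comp m'))) (0, c) :=
      L.subtypeL.hasFDerivAt.comp ((0, c) : K × ℝ × ℝ) hρΘd.hasFDerivAt
    refine (h1.congr_of_eventuallyEq ?_).unique hΘd.hasFDerivAt
    filter_upwards [hΘL] with v hv
    exact (congrArg Subtype.val (hρ ⟨Θ v, hv.1⟩)).symm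
  have hinj : Function.Injective (ρ.comp (DF.comp m')) := by
    rw [injective_iff_map_eq_zero]
    intro v hv
    have h1 : DF (m' v) = 0 := by
      have h2 := DFunLike.congr_fun hfix v
      change ((ρ.comp (DF.comp m') v : L) : HomCoord n) = DF (m' v) at h2
      rw [← h2, hv]
      rfl
    have h3 : m' v = 0 := (injective_iff_map_eq_zero DF).1 hq.2 _ h1
    have h4 : (v.1 : (Fin n → ℝ) × ℝ × ℝ).1 = 0 := congrArg Prod.fst h3
    have h5 : v.2 = 0 := congrArg Prod.snd h3
    -- A kernel vector of `D` without `u`-component vanishes, because `Z_{n+1}` and `Z_{n+2}` of its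
    -- image are its last two components. So the fibre really moves `u`.
    have h6 : D (v.1 : (Fin n → ℝ) × ℝ × ℝ) = 0 := v.1.2
    rw [hD, hS.fderiv_rulingPoint_dual hu, h4] at h6
    simp only [map_zero, zero_add, dualP, dualR, Prod.ext_iff, Prod.fst_add, Prod.snd_add,
      Prod.smul_fst, Prod.smul_snd, smul_eq_mul, Prod.fst_zero, Prod.snd_zero] at h6
    refine Prod.ext (Subtype.ext (Prod.ext h4 (Prod.ext ?_ ?_))) h5
    · simpa using h6.2.2.1
    · simpa using h6.2.2.2.1
  -- Dimension count: `dim L = n + 4 - dim R = dim K + 2`. Surjectivity of the strict derivative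
  -- then makes the generators over the fibre fill a neighbourhood in `L`.
  have hsurj : Function.Surjective (ρ.comp (DF.comp m')) := by
    refine (LinearMap.injective_iff_surjective_of_finrank_eq_finrank
      (f := (ρ.comp (DF.comp m') : K × ℝ × ℝ →ₗ[ℝ] L)) ?_).1 hinj
    rw [hdimL]
    simp only [Module.finrank_prod, Module.finrank_self]
    omega
  have hmap := hρΘd.map_nhds_eq_of_surj (LinearMap.range_eq_top.2 hsurj)
  have hbase : ρ (Θ (0, c)) = ⟨rulingPoint S.p S.r (u, c), hmemL⟩ := by
    rw [hΘ0]
    exact hρ ⟨_, hmemL⟩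
  -- Since `K ≠ 0`, `dim L ≥ 3`; cutting down to a plane makes the ruling dimension independent of
  -- the point.
  obtain ⟨L', hL'L, hmem', hdim'⟩ := exists_submodule_finrank_eq L _ hmemL 3 (by norm_num)
    (by omega)
  refine ⟨L', hdim', hmem', ?_⟩
  refine Filter.Eventually.filter_mono (nhdsWithin_mono _ hL'L) ?_
  rw [nhdsWithin_eq_map_subtype_coe (s := (L : Set (HomCoord n))) hmemL, Filter.eventually_map]
  change ∀ᶠ l in 𝓝 (⟨_, hmemL⟩ : L), _
  rw [← hbase, ← hmap, Filter.eventually_map]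
  filter_upwards [hΘL] with v hv hy
  refine ⟨_, hv.2, ?_⟩
  rw [Projectivization.submodule_mk, Submodule.span_singleton_le_iff_mem, hρ ⟨Θ v, hv.1⟩,
    mem_generator_iff]
  exact ⟨_, _, rfl⟩

/-- If the dual has no regular points, then the swept out set is ruled by planes. -/
theorem HasTwoLaws.isRuledBy_two (hS : S.HasTwoLaws U)
    (hempty : ¬ (regularSet S.dualP S.dualR U).Nonempty) : IsRuledBy S.p S.r U 2 := by
  set rk : (Fin n → ℝ) × ℝ × ℝ → ℕ :=
    fun x => Module.finrank ℝ (projTangent S.dualP S.dualR x) with hrk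
  -- One dual point of locally constant rank on the dual generator of `u` suffices for all regular
  -- points of the primal generator of `u`.
  set V : Set (Fin n → ℝ) := {u | u ∈ U ∧ ∃ c : ℝ × ℝ, ∀ᶠ x in 𝓝 (u, c), rk x = rk (u, c)} with hV
  have hVo : IsOpen V := by
    rw [isOpen_iff_mem_nhds]
    rintro u ⟨hu, c, hc⟩
    have h1 : Filter.Tendsto (fun u' : Fin n → ℝ => (u', c)) (𝓝 u) (𝓝 (u, c)) :=
      (Continuous.prodMk_left c).tendsto u
    filter_upwards [hS.isOpen.mem_nhds hu, h1.eventually hc.eventually_nhds] with u' hu' hc'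
    refine ⟨hu', c, ?_⟩
    filter_upwards [hc'] with x hx
    rw [hx, hc'.self_of_nhds]
  have hUo : IsOpen (U ×ˢ (Set.univ : Set (ℝ × ℝ))) := hS.isOpen.prod isOpen_univ
  refine ⟨{q | q.1 ∈ V ∧ IsRegularAt S.p S.r q}, fun q hq => ⟨hq.1.1, hq.2⟩, ?_, ?_, ?_⟩
  · have h1 : ContinuousOn (fderiv ℝ (rulingPoint S.p S.r)) (V ×ˢ Set.univ) :=
      ((hS.contDiffOn_p.rulingPoint hS.contDiffOn_r).continuousOn_fderiv_of_isOpen hUo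
        (by simp)).mono fun q hq => ⟨hq.1.1, hq.2⟩
    have h2 := h1.isOpen_inter_preimage (hVo.prod isOpen_univ)
      (ContinuousLinearMap.isOpen_injective (𝕜 := ℝ))
    convert h2 using 1
    ext q
    simp [IsRegularAt]
  · refine subset_closure_of_pencil hS.isOpen fun W hWU hW hne => ?_
    have h1 : ContinuousOn (fderiv ℝ (rulingPoint S.dualP S.dualR)) (W ×ˢ Set.univ) :=
      ((hS.contDiffOn_dualP.rulingPoint hS.contDiffOn_dualR).continuousOn_fderiv_of_isOpen hUo
        (by simp)).mono (Set.prod_mono hWU subset_rfl)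
    obtain ⟨⟨u, c⟩, hx, hev⟩ := exists_eventually_finrank_range_eq
      (hW.prod isOpen_univ) (hne.prod Set.univ_nonempty) h1
    refine ⟨u, hx.1, ContinuousLinearMap.id ℝ _, fderiv ℝ S.f u, ⟨(1, 0), ?_⟩, fun c' hc' => ?_⟩
    · simp [pencil, Function.Injective]
    · exact ⟨⟨hWU hx.1, c, hev⟩, (hS.isRegularAt_iff (q := (u, c')) (hWU hx.1)).2 hc'⟩
  · rintro ⟨u, c⟩ ⟨⟨hu, c₀, hc₀⟩, hreg⟩
    exact hS.exists_subspace_of_rank_lt (c₀ := c₀) ⟨hu, hreg⟩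
      (fun h => hempty ⟨(u, c₀), hu, h⟩) hc₀

/-- The codimension argument applies over each nonempty open `W` and yields one regular point there;
the pencil of Hessians spreads it to a dense set of `(s, t)` over the same `u`. -/
theorem HasTwoLaws.subset_closure_regularSet_dual (hS : S.HasTwoLaws U)
    (hruled : ∀ W ⊆ U, IsOpen W → W.Nonempty → ¬ IsRuledBy S.p S.r W 2) :
    U ×ˢ Set.univ ⊆ closure (regularSet S.dualP S.dualR U) := by
  refine subset_closure_of_pencil hS.isOpen fun W hWU hW hne => ?_
  obtain ⟨⟨u, c⟩, hu, hreg⟩ := not_not.1 (mt (hS.mono hW hWU).isRuledBy_two (hruled W hWU hW hne))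
  refine ⟨u, hu, _, _, ⟨c, (hS.isRegularAt_dual_iff (hWU hu)).1 hreg⟩, fun c' hc' =>
    ⟨hWU hu, (hS.isRegularAt_dual_iff (q := (u, c')) (hWU hu)).2 hc'⟩⟩

theorem HasTwoLaws.subset_closure_regularSet_dual_of_isAnalytic (hS : S.HasTwoLaws U)
    (han : S.IsAnalytic U) (hU : IsPreconnected U)
    (hne : (regularSet S.dualP S.dualR U).Nonempty) :
    U ×ˢ Set.univ ⊆ closure (regularSet S.dualP S.dualR U) := by
  obtain ⟨q₀, hq₀, hreg⟩ := hne
  have h1 : AnalyticOnNhd ℝ S.dualPencil (U ×ˢ Set.univ) := by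
    intro q hq
    have hB : AnalyticAt ℝ (fun q : (Fin n → ℝ) × ℝ × ℝ => fderiv ℝ (partials S.B) q.1) q :=
      (han.2.1.partials.fderiv q.1 hq.1).comp analyticAt_fst
    have hN : AnalyticAt ℝ (fun q : (Fin n → ℝ) × ℝ × ℝ => fderiv ℝ (partials S.N) q.1) q :=
      (han.2.2.2.1.partials.fderiv q.1 hq.1).comp analyticAt_fst
    have hs : AnalyticAt ℝ (fun q : (Fin n → ℝ) × ℝ × ℝ => q.2.1) q :=
      analyticAt_fst.comp analyticAt_snd
    have ht : AnalyticAt ℝ (fun q : (Fin n → ℝ) × ℝ × ℝ => q.2.2) q :=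
      analyticAt_snd.comp analyticAt_snd
    exact (hs.smul hB).add (ht.smul hN)
  refine (subset_closure_setOf_injective (hS.isOpen.prod isOpen_univ)
    (hU.prod isPreconnected_univ) h1 (x₀ := q₀) ⟨hq₀, trivial⟩
    ((hS.isRegularAt_dual_iff hq₀).1 hreg)).trans (closure_mono ?_)
  rintro q ⟨hq, hinj⟩
  exact ⟨hq.1, (hS.isRegularAt_dual_iff hq.1).2 hinj⟩

end ConsSystem

/-! ### The dual generators as the generators of a system. -/

/-- In the coordinates `v = φ(u)` the gradient of the density is `-a`; since the flux satisfies `dα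
= -a · dκ` with the same `a`, this is the law for the system with flux `κ`. -/
theorem isConservationLaw_comp_symm {n : ℕ}
    {φ : OpenPartialHomeomorph (Fin n → ℝ) (Fin n → ℝ)} {β α : (Fin n → ℝ) → ℝ}
    {κ a : (Fin n → ℝ) → (Fin n → ℝ)}
    {φ' κ' : (Fin n → ℝ) → (Fin n → ℝ) →L[ℝ] (Fin n → ℝ)}
    (hsymm : ∀ v ∈ φ.target, DifferentiableAt ℝ φ.symm v)
    (hφ : ∀ u ∈ φ.source, HasFDerivAt φ (φ' u) u)
    (hκ : ∀ u ∈ φ.source, HasFDerivAt κ (κ' u) u)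
    (hβ : ∀ u ∈ φ.source, HasFDerivAt β (-(dotCLM (a u)).comp (φ' u)) u)
    (hα : ∀ u ∈ φ.source, HasFDerivAt α (-(dotCLM (a u)).comp (κ' u)) u) :
    IsConservationLaw (κ ∘ φ.symm) φ.target (β ∘ φ.symm) (α ∘ φ.symm) := by
  rintro v hv ux _ rfl
  have hu := φ.map_target hv
  have hQ := (hsymm v hv).hasFDerivAt
  have hid : (φ' (φ.symm v)).comp (fderiv ℝ φ.symm v) = ContinuousLinearMap.id ℝ _ := by
    refine (((hφ _ hu).comp v hQ).congr_of_eventuallyEq ?_).unique (hasFDerivAt_id v)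
    exact (φ.eventually_right_inverse hv).mono fun w hw => hw.symm
  have hid' : ∀ w, φ' (φ.symm v) (fderiv ℝ φ.symm v w) = w := fun w => DFunLike.congr_fun hid w
  rw [((hβ _ hu).comp v hQ).fderiv, ((hα _ hu).comp v hQ).fderiv, ((hκ _ hu).comp v hQ).fderiv]
  simp [hid']

/-- The change of basis has determinant `s² + t²`. -/
theorem span_pair_rotate {E : Type*} [AddCommGroup E] [Module ℝ E] (x y : E) {s t : ℝ}
    (h : s ^ 2 + t ^ 2 ≠ 0) :
    Submodule.span ℝ {s • x + t • y, (-t) • x + s • y} = Submodule.span ℝ {x, y} := by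
  refine le_antisymm (Submodule.span_le.2 ?_) (Submodule.span_le.2 ?_)
  · rintro _ (rfl | rfl)
    · exact Submodule.mem_span_pair.2 ⟨_, _, rfl⟩
    · exact Submodule.mem_span_pair.2 ⟨_, _, rfl⟩
  · rintro _ (rfl | rfl)
    · refine Submodule.mem_span_pair.2 ⟨s / (s ^ 2 + t ^ 2), -t / (s ^ 2 + t ^ 2), ?_⟩
      match_scalars <;> field_simp <;> ring
    · refine Submodule.mem_span_pair.2 ⟨t / (s ^ 2 + t ^ 2), s / (s ^ 2 + t ^ 2), ?_⟩
      match_scalars <;> field_simp <;> ring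

/-- The coordinate change of `ℙⁿ⁺³` taking the standard position of the generators of a system to
the position of the dual generators, with the pair of last coordinates rotated by `(s, t)`. -/
def dualCoordChange (n : ℕ) {s t : ℝ} (h : s ^ 2 + t ^ 2 ≠ 0) : HomCoord n ≃ₗ[ℝ] HomCoord n where
  toFun y := (y.2.2.1, y.2.1, s * y.1 - t * y.2.2.2.2, t * y.1 + s * y.2.2.2.2, y.2.2.2.1)
  map_add' y y' := by
    simp only [Prod.ext_iff, Prod.fst_add, Prod.snd_add]
    refine ⟨trivial, trivial, by ring, by ring, trivial⟩
  map_smul' c y := by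
    simp only [Prod.ext_iff, Prod.smul_fst, Prod.smul_snd, smul_eq_mul, RingHom.id_apply]
    refine ⟨trivial, trivial, by ring, by ring, trivial⟩
  invFun z := ((s * z.2.2.1 + t * z.2.2.2.1) / (s ^ 2 + t ^ 2), z.2.1, z.1, z.2.2.2.2,
    (-t * z.2.2.1 + s * z.2.2.2.1) / (s ^ 2 + t ^ 2))
  left_inv y := by
    simp only [Prod.ext_iff]
    refine ⟨?_, trivial, trivial, trivial, ?_⟩ <;> field_simp <;> ring
  right_inv z := by
    simp only [Prod.ext_iff]
    refine ⟨trivial, trivial, ?_, ?_, trivial⟩ <;> field_simp <;> ring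

namespace ConsSystem

variable {n : ℕ} {S : ConsSystem n} {U : Set (Fin n → ℝ)} {u : Fin n → ℝ}

/-- The point with parameters `(a, b)` on the dual generator. -/
def dualPoint (S : ConsSystem n) (a b : ℝ) (u : Fin n → ℝ) : HomCoord n :=
  a • S.dualP u + b • S.dualR u

theorem HasTwoLaws.hasFDerivAt_dualPoint (hS : S.HasTwoLaws U) (hu : u ∈ U) (a b : ℝ) :
    HasFDerivAt (S.dualPoint a b) ((dualLift u (S.f u)).comp (S.dualPencil (u, a, b))) u := by
  refine (((hS.hasFDerivAt_dualP hu).const_smul a).add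
    ((hS.hasFDerivAt_dualR hu).const_smul b)).congr_fderiv ?_
  ext1 w
  simp [dualPencil]

theorem HasTwoLaws.contDiffOn_dualPoint (hS : S.HasTwoLaws U) (a b : ℝ) :
    ContDiffOn ℝ ∞ (S.dualPoint a b) U :=
  (hS.contDiffOn_dualP.const_smul a).add (hS.contDiffOn_dualR.const_smul b)

theorem HasTwoLaws.hasFDerivAt_dualPoint_gradient (hS : S.HasTwoLaws U) (hu : u ∈ U) (a b : ℝ) :
    HasFDerivAt (fun u => (S.dualPoint a b u).2.1) (-S.dualPencil (u, a, b)) u := by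
  refine (hS.hasFDerivAt_dualPoint hu a b).snd.fst.congr_fderiv ?_
  ext1 w
  simp [dualLift_apply]

theorem HasTwoLaws.hasFDerivAt_dualPoint_fst (hS : S.HasTwoLaws U) (hu : u ∈ U) (a b : ℝ) :
    HasFDerivAt (fun u => (S.dualPoint a b u).1)
      (-(dotCLM u).comp (-S.dualPencil (u, a, b))) u := by
  refine (hS.hasFDerivAt_dualPoint hu a b).fst.congr_fderiv ?_
  ext1 w
  simp [dualLift_apply]

theorem HasTwoLaws.hasFDerivAt_dualPoint_last (hS : S.HasTwoLaws U) (hu : u ∈ U) (a b : ℝ) :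
    HasFDerivAt (fun u => (S.dualPoint a b u).2.2.2.2)
      (-(dotCLM (S.f u)).comp (-S.dualPencil (u, a, b))) u := by
  refine (hS.hasFDerivAt_dualPoint hu a b).snd.snd.snd.snd.congr_fderiv ?_
  ext1 w
  simp [dualLift_apply]

/-- Near a regular point of the dual, the gradient coordinates are a local diffeomorphism. -/
theorem HasTwoLaws.exists_gradient_chart (hS : S.HasTwoLaws U) {s t : ℝ} (hu : u ∈ U)
    (hreg : Function.Injective (S.dualPencil (u, s, t))) :
    ∃ φ : OpenPartialHomeomorph (Fin n → ℝ) (Fin n → ℝ), u ∈ φ.source ∧ φ.source ⊆ U ∧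
      (φ : (Fin n → ℝ) → (Fin n → ℝ)) = (fun u => (S.dualPoint s t u).2.1) ∧
      ContDiffOn ℝ ∞ φ φ.source ∧ ContDiffOn ℝ ∞ φ.symm φ.target := by
  set g : (Fin n → ℝ) → (Fin n → ℝ) := fun u => (S.dualPoint s t u).2.1 with hg
  have hgc : ContDiffOn ℝ ∞ g U := (hS.contDiffOn_dualPoint s t).snd.fst
  have hgd : ∀ x ∈ U, fderiv ℝ g x = -S.dualPencil (x, s, t) := fun x hx =>
    (hS.hasFDerivAt_dualPoint_gradient hx s t).fderiv
  have hequiv : ∀ x ∈ U, Function.Injective (fderiv ℝ g x) →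
      ∃ e : (Fin n → ℝ) ≃L[ℝ] (Fin n → ℝ), HasFDerivAt g (e : (Fin n → ℝ) →L[ℝ] (Fin n → ℝ)) x := by
    intro x hx hinj
    refine ⟨ContinuousLinearEquiv.ofBijective (fderiv ℝ g x) (LinearMap.ker_eq_bot.2 hinj)
      (LinearMap.range_eq_top.2 (surjective_of_injective_pi hinj)), ?_⟩
    rw [ContinuousLinearEquiv.coe_ofBijective]
    exact hgc.hasFDerivAt_of_isOpen hS.isOpen hx
  have hinj₀ : Function.Injective (fderiv ℝ g u) := by
    rw [hgd u hu]
    exact neg_injective.comp hreg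
  obtain ⟨e, he⟩ := hequiv u hu hinj₀
  have hW : IsOpen (U ∩ fderiv ℝ g ⁻¹' {A | Function.Injective A}) :=
    (hgc.continuousOn_fderiv_of_isOpen hS.isOpen (by simp)).isOpen_inter_preimage hS.isOpen
      (ContinuousLinearMap.isOpen_injective (𝕜 := ℝ))
  have hc := hgc.contDiffAt (hS.isOpen.mem_nhds hu)
  set φ := (hc.toOpenPartialHomeomorph g he (by simp)).restrOpen _ hW with hφ
  have hsub : φ.source ⊆ U := fun x hx => hx.2.1
  refine ⟨φ, ⟨hc.mem_toOpenPartialHomeomorph_source he (by simp), hu, hinj₀⟩, hsub, rfl,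
    hgc.mono hsub, fun v hv => ?_⟩
  have hv' := φ.map_target hv
  obtain ⟨e', he'⟩ := hequiv _ hv'.2.1 hv'.2.2
  exact (φ.contDiffAt_symm hv he'
    (hgc.contDiffAt (hS.isOpen.mem_nhds hv'.2.1))).contDiffWithinAt

/-- The system of conservation laws whose generators are dual generators. -/
def dualSystem (S : ConsSystem n) (s t : ℝ) (σ : (Fin n → ℝ) → (Fin n → ℝ)) : ConsSystem n where
  f := (fun u => (S.dualPoint (-t) s u).2.1) ∘ σ
  B := (fun u => (S.dualPoint s t u).1) ∘ σ
  A := (fun u => (S.dualPoint (-t) s u).1) ∘ σ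
  N := (fun u => (S.dualPoint s t u).2.2.2.2) ∘ σ
  M := (fun u => (S.dualPoint (-t) s u).2.2.2.2) ∘ σ

/-- All coordinates of the dual points have differentials proportional to that of the gradient
block, with factor `-u` for the first coordinate and `-f` for the last. These factors are the `a` of
the two laws. -/
theorem HasTwoLaws.dualSystem (hS : S.HasTwoLaws U) {s t : ℝ}
    {φ : OpenPartialHomeomorph (Fin n → ℝ) (Fin n → ℝ)} (hφU : φ.source ⊆ U)
    (hφ : (φ : (Fin n → ℝ) → (Fin n → ℝ)) = fun u => (S.dualPoint s t u).2.1)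
    (hsymm : ContDiffOn ℝ ∞ φ.symm φ.target) :
    (S.dualSystem s t φ.symm).HasTwoLaws φ.target := by
  have hmaps : Set.MapsTo φ.symm φ.target U := fun v hv => hφU (φ.map_target hv)
  have hc := fun a b => (hS.contDiffOn_dualPoint a b).comp hsymm hmaps
  have hd : ∀ v ∈ φ.target, DifferentiableAt ℝ φ.symm v := fun v hv =>
    (hsymm.hasFDerivAt_of_isOpen φ.open_target hv).differentiableAt
  have hφd : ∀ u ∈ φ.source, HasFDerivAt φ (-S.dualPencil (u, s, t)) u := by
    intro u hu
    rw [hφ]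
    exact hS.hasFDerivAt_dualPoint_gradient (hφU hu) s t
  exact
    { isOpen := φ.open_target
      smooth_f := (hc _ _).snd.fst
      smooth_B := (hc _ _).fst
      smooth_A := (hc _ _).fst
      smooth_N := (hc _ _).snd.snd.snd.snd
      smooth_M := (hc _ _).snd.snd.snd.snd
      law_BA := isConservationLaw_comp_symm (a := id) hd hφd
        (fun u hu => hS.hasFDerivAt_dualPoint_gradient (hφU hu) _ _)
        (fun u hu => hS.hasFDerivAt_dualPoint_fst (hφU hu) _ _)
        (fun u hu => hS.hasFDerivAt_dualPoint_fst (hφU hu) _ _)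
      law_NM := isConservationLaw_comp_symm (a := S.f) hd hφd
        (fun u hu => hS.hasFDerivAt_dualPoint_gradient (hφU hu) _ _)
        (fun u hu => hS.hasFDerivAt_dualPoint_last (hφU hu) _ _)
        (fun u hu => hS.hasFDerivAt_dualPoint_last (hφU hu) _ _) }

theorem dualCoordChange_p {s t : ℝ} (h : s ^ 2 + t ^ 2 ≠ 0)
    {σ : (Fin n → ℝ) → (Fin n → ℝ)} {v : Fin n → ℝ} (hv : (S.dualPoint s t (σ v)).2.1 = v) :
    dualCoordChange n h ((S.dualSystem s t σ).p v) = S.dualPoint s t (σ v) := by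
  simp only [dualCoordChange, LinearEquiv.coe_mk, p, dualSystem, Prod.ext_iff]
  refine ⟨rfl, hv.symm, ?_, ?_, rfl⟩ <;> simp [dualPoint, dualP, dualR]

theorem dualCoordChange_r {s t : ℝ} (h : s ^ 2 + t ^ 2 ≠ 0)
    {σ : (Fin n → ℝ) → (Fin n → ℝ)} {v : Fin n → ℝ} :
    dualCoordChange n h ((S.dualSystem s t σ).r v) = S.dualPoint (-t) s (σ v) := by
  simp only [dualCoordChange, LinearEquiv.coe_mk, r, dualSystem, Prod.ext_iff]
  refine ⟨rfl, rfl, ?_, ?_, rfl⟩ <;> simp [dualPoint, dualP, dualR]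

theorem generator_dual_eq_map {s t : ℝ} (h : s ^ 2 + t ^ 2 ≠ 0)
    {σ : (Fin n → ℝ) → (Fin n → ℝ)} {v : Fin n → ℝ} (hv : (S.dualPoint s t (σ v)).2.1 = v) :
    generator S.dualP S.dualR (σ v) =
      (generator (S.dualSystem s t σ).p (S.dualSystem s t σ).r v).map
        (dualCoordChange n h : HomCoord n →ₗ[ℝ] HomCoord n) := by
  rw [generator, generator, Submodule.map_span, Set.image_pair]
  change _ = Submodule.span ℝ {dualCoordChange n h _, dualCoordChange n h _}
  rw [dualCoordChange_p h hv, dualCoordChange_r h]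
  exact (span_pair_rotate _ _ h).symm

/-- A linear relation among the new forms is a vector orthogonal to all dual generators over the
chart. -/
theorem independent_dualSystem {s t : ℝ} (h : s ^ 2 + t ^ 2 ≠ 0)
    {φ : OpenPartialHomeomorph (Fin n → ℝ) (Fin n → ℝ)}
    (hφ : (φ : (Fin n → ℝ) → (Fin n → ℝ)) = fun u => (S.dualPoint s t u).2.1)
    (hy : ∀ y : HomCoord n, (∀ u ∈ φ.source,
      incidence (S.dualP u) y = 0 ∧ incidence (S.dualR u) y = 0) → y = 0) :
    (S.dualSystem s t φ.symm).Independent φ.target := by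
  intro a b c d e habc
  -- The pair `(a, b)` is rotated back so that the two relations become incidence of this vector
  -- with `dualPoint s t` and `dualPoint (-t) s`.
  have h0 := hy (d, c, (s * a - t * b) / (s ^ 2 + t ^ 2), (t * a + s * b) / (s ^ 2 + t ^ 2), e) ?_
  · simp only [Prod.ext_iff, Prod.fst_zero, Prod.snd_zero, div_eq_zero_iff, h, or_false] at h0
    obtain ⟨hd, hc, h1, h2, he⟩ := h0
    have ha : a * (s ^ 2 + t ^ 2) = 0 := by linear_combination s * h1 + t * h2
    have hb : b * (s ^ 2 + t ^ 2) = 0 := by linear_combination s * h2 - t * h1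
    exact ⟨(mul_eq_zero.1 ha).resolve_right h, (mul_eq_zero.1 hb).resolve_right h, hc, hd, he⟩
  · intro u hu
    obtain ⟨h1, h2⟩ := habc (φ u) (φ.map_source hu)
    simp only [dualSystem, Function.comp_apply, φ.left_inv hu] at h1 h2
    have hφu : φ u = (S.dualPoint s t u).2.1 := congrFun hφ u
    rw [hφu] at h1
    simp only [dualPoint, dualP, dualR, Prod.fst_add, Prod.snd_add, Prod.smul_fst, Prod.smul_snd,
      smul_eq_mul, dotProduct_comm c, add_dotProduct, smul_dotProduct] at h1 h2
    simp only [incidence, dualP, dualR]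
    constructor
    · refine (mul_eq_zero.1 (?_ : _ * (s ^ 2 + t ^ 2) = 0)).resolve_right h
      field_simp
      linear_combination s * h1 - t * h2
    · refine (mul_eq_zero.1 (?_ : _ * (s ^ 2 + t ^ 2) = 0)).resolve_right h
      field_simp
      linear_combination t * h1 + s * h2

/-- For `n = 0` the form `B dx + A dt` has constant coefficients, so it is a combination of `dx` and
`dt`. -/
theorem Independent.dim_ne_zero (h : S.Independent U) : n ≠ 0 := by
  rintro rfl
  have h1 := h (-S.B 0) (-S.A 0) 0 1 0 fun u _ => by
    obtain rfl : u = 0 := Subsingleton.elim _ _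
    simp
  exact one_ne_zero h1.2.2.2.1

/-- For `n = 0` the zero pencil is injective too, which is why `n ≠ 0` is required. -/
theorem sq_add_sq_ne_zero_of_injective (hn : n ≠ 0) {s t : ℝ}
    (h : Function.Injective (S.dualPencil (u, s, t))) : s ^ 2 + t ^ 2 ≠ 0 := by
  intro h0
  have hs : s = 0 := by nlinarith
  have ht : t = 0 := by nlinarith
  subst hs ht
  have : Nonempty (Fin n) := ⟨⟨0, Nat.pos_of_ne_zero hn⟩⟩
  obtain ⟨w, hw⟩ := exists_ne (0 : Fin n → ℝ)
  exact hw (h (by simp [dualPencil]))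

/-- The identity theorem carries a relation from a chart to all of `U`, where nonconcurrence of the
tangent spaces is assumed. -/
theorem incidence_dual_eq_zero_of_isAnalytic (han : S.IsAnalytic U) (hU : IsPreconnected U)
    {W : Set (Fin n → ℝ)} (hW : IsOpen W) (hWU : W ⊆ U) (hu : u ∈ W) {y : HomCoord n}
    (hy : ∀ u ∈ W, incidence (S.dualP u) y = 0 ∧ incidence (S.dualR u) y = 0) :
    ∀ u ∈ U, incidence (S.dualP u) y = 0 ∧ incidence (S.dualR u) y = 0 := by
  obtain ⟨hf, hB, hA, hN, hM⟩ := han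
  have hP : AnalyticOnNhd ℝ (fun u => incidence (S.dualP u) y) U := by
    intro x hx
    have h := hB.partials x hx
    simp only [incidence, dualP]
    exact (((((analyticAt_id.dotProduct h).sub (hB x hx)).mul analyticAt_const).add
      (h.neg.dotProduct analyticAt_const)).add analyticAt_const).add analyticAt_const |>.add
      ((((hf x hx).dotProduct h).sub (hA x hx)).mul analyticAt_const)
  have hR : AnalyticOnNhd ℝ (fun u => incidence (S.dualR u) y) U := by
    intro x hx
    have h := hN.partials x hx
    simp only [incidence, dualR]
    exact (((((analyticAt_id.dotProduct h).sub (hN x hx)).mul analyticAt_const).add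
      (h.neg.dotProduct analyticAt_const)).add analyticAt_const).add analyticAt_const |>.add
      ((((hf x hx).dotProduct h).sub (hM x hx)).mul analyticAt_const)
  intro x hx
  exact ⟨hP.eqOn_zero_of_preconnected_of_eventuallyEq_zero hU (hWU hu)
      (Filter.mem_of_superset (hW.mem_nhds hu) fun v hv => (hy v hv).1) hx,
    hR.eqOn_zero_of_preconnected_of_eventuallyEq_zero hU (hWU hu)
      (Filter.mem_of_superset (hW.mem_nhds hu) fun v hv => (hy v hv).2) hx⟩

theorem HasTwoLaws.exists_dualSystem (hS : S.HasTwoLaws U) (hn : n ≠ 0)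
    (hconc : ¬ TangentsConcurrent S.p S.r U) {q : (Fin n → ℝ) × ℝ × ℝ}
    (hq : q ∈ regularSet S.dualP S.dualR U) :
    ∃ (S' : ConsSystem n) (φ : OpenPartialHomeomorph (Fin n → ℝ) (Fin n → ℝ))
      (T : HomCoord n ≃ₗ[ℝ] HomCoord n),
      q.1 ∈ φ.source ∧ φ.source ⊆ U ∧
      ContDiffOn ℝ ∞ φ φ.source ∧ ContDiffOn ℝ ∞ φ.symm φ.target ∧
      S'.HasTwoLaws φ.target ∧
      (∀ u ∈ φ.source, generator S.dualP S.dualR u =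
        (generator S'.p S'.r (φ u)).map (T : HomCoord n →ₗ[ℝ] HomCoord n)) ∧
      ((S.IsAnalytic U ∧ IsPreconnected U) ∨ ¬ TangentsConcurrent S.p S.r φ.source →
        S'.Independent φ.target) := by
  obtain ⟨u, s, t⟩ := q
  have hinj := (hS.isRegularAt_dual_iff hq.1).1 hq.2
  have hst := sq_add_sq_ne_zero_of_injective hn hinj
  obtain ⟨φ, hu, hφU, hφ, hc, hsymm⟩ := hS.exists_gradient_chart hq.1 hinj
  refine ⟨S.dualSystem s t φ.symm, φ, dualCoordChange n hst, hu, hφU, hc, hsymm,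
    hS.dualSystem hφU hφ hsymm, fun x hx => ?_, fun h => ?_⟩
  · have hx' : (S.dualPoint s t (φ.symm (φ x))).2.1 = φ x := by
      rw [φ.left_inv hx]
      exact (congrFun hφ x).symm
    have := generator_dual_eq_map hst hx'
    rwa [φ.left_inv hx] at this
  · refine independent_dualSystem hst hφ fun y hy => ?_
    by_contra hy0
    rcases h with ⟨han, hU⟩ | h
    · exact hconc (tangentsConcurrent_of_incidence hS hy0
        (incidence_dual_eq_zero_of_isAnalytic han hU φ.open_source hφU hu hy))
    · exact h (tangentsConcurrent_of_incidence (hS.mono φ.open_source hφU) hy0 hy)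

end ConsSystem

end

theorem theorem2 {n : ℕ} (S : ConsSystem n) (U : Set (Fin n → ℝ))
    (hS : S.HasTwoLaws U) (hind : S.Independent U)
    (hruled : ∀ k : ℕ, 1 < k → ¬ IsRuledBy S.p S.r U k)
    (hconc : ¬ TangentsConcurrent S.p S.r U) :
    -- the dual hypersurface is ruled by the explicit dual generators
    (∀ q ∈ regularSet S.p S.r U, ∀ Z : HomCoord n,
      (∀ Y ∈ projTangent S.p S.r q, incidence Z Y = 0) ↔ Z ∈ generator S.dualP S.dualR q.1) ∧
    dualSet S.p S.r U = ruledSet S.dualP S.dualR U ∧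
    -- it has codimension two
    (regularSet S.dualP S.dualR U).Nonempty ∧
    ((S.IsAnalytic U ∧ IsPreconnected U) ∨
        (∀ W ⊆ U, IsOpen W → W.Nonempty → ∀ k : ℕ, 1 < k → ¬ IsRuledBy S.p S.r W k) →
      U ×ˢ Set.univ ⊆ closure (regularSet S.dualP S.dualR U)) ∧
    -- it is nondegenerate
    Projectivization.Subspace.span (dualSet S.p S.r U) = ⊤ ∧
    -- its projective tangent spaces are stable along its generators
    TangentsStable S.dualP S.dualR U ∧
    -- it comes from a system of conservation laws with two additional conservation laws
    (∀ q ∈ regularSet S.dualP S.dualR U,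
      ∃ (S' : ConsSystem n) (φ : OpenPartialHomeomorph (Fin n → ℝ) (Fin n → ℝ))
        (T : HomCoord n ≃ₗ[ℝ] HomCoord n),
        q.1 ∈ φ.source ∧ φ.source ⊆ U ∧
        ContDiffOn ℝ ∞ φ φ.source ∧ ContDiffOn ℝ ∞ φ.symm φ.target ∧
        S'.HasTwoLaws φ.target ∧
        (∀ u ∈ φ.source, generator S.dualP S.dualR u =
          (generator S'.p S'.r (φ u)).map (T : HomCoord n →ₗ[ℝ] HomCoord n)) ∧
        ((S.IsAnalytic U ∧ IsPreconnected U) ∨ ¬ TangentsConcurrent S.p S.r φ.source →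
          S'.Independent φ.target)) := by
  have hne : (regularSet S.dualP S.dualR U).Nonempty := by
    by_contra h
    -- The degenerate case always produces planes, so `k = 2` is the only instance of the ruling
    -- hypothesis needed.
    exact hruled 2 one_lt_two (hS.isRuledBy_two h)
  refine ⟨fun q hq => ConsSystem.incidence_projTangent_eq_zero_iff hS hq,
    ConsSystem.dualSet_eq_ruledSet hS, hne, ?_, ConsSystem.span_dualSet_eq_top hS hconc,
    ConsSystem.tangentsStable_dual hS, fun q hq => hS.exists_dualSystem hind.dim_ne_zero hconc hq⟩
  rintro (⟨han, hU⟩ | h)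
  · exact hS.subset_closure_regularSet_dual_of_isAnalytic han hU hne
  · exact hS.subset_closure_regularSet_dual fun W hWU hW hWne => h W hWU hW hWne 2 one_lt_two
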